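/- Conventions. For a commutative semigroup $H$ with identity, $H^{\times}$ is its group of units and $H_{\mathrm{red}}=\{aH^{\times}\mid a\in H\}$. $H$ is unit-cancellative if $a=au$ implies $u\in H^{\times}$. An atom is a non-unit $u$ such that $u=bc$ implies $b\in H^\times$ or $c\in H^\times$, and $H$ is atomic if every non-unit is a finite product of atoms. A factorization of $a\in H$ is a finite multiset $z$ of atoms of $H_{\mathrm{red}}$ with product $aH^\times$; $|z|$ is its length, and $\mathsf L(a)$ is the set of lengths of factorizations of $a$. $H$ is half-factorial if it is atomic and $|\mathsf L(a)|=1$ for all $a\in H$. The set of distances $\Delta(H)$ is the set of all $d\in\mathbb N$ for which there are $a\in H$ and $k\in\mathsf L(a)$ with $\mathsf L(a)\cap[k,k+d]=\{k,k+d\}$ (so $d\ge 1$). Put $$\gimel(H)=\sup\{\min(\mathsf L(a)\setminus\{2\})\mid a\in H,\ 2\in \mathsf L(a),\ |\mathsf L(a)|>1\}$$ (with $\sup\emptyset=0$; this is the invariant written ג in the summary). The distance of two factorizations $z=xy$ and $z'=xy'$, with $x$ their greatest common divisor, is $\max\{|y|,|y'|\}$. The catenary degree $\mathsf c(H)\in\mathbb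 N_0\cup\{\infty\}$ is the smallest $N$ such that, for every $a\in H$, any two factorizations of $a$ can be joined by a finite sequence of factorizations of $a$ in which consecutive members have distance at most $N$. A Krull monoid is a cancellative monoid that is completely integrally closed and satisfies the ascending chain condition on divisorial ideals. $H$ is transfer Krull if there is a homomorphism $\theta\colon H\to B$ into a Krull monoid $B$ such that $B=\theta(H)B^\times$, $\theta^{-1}(B^\times)=H^\times$, and whenever $\theta(u)=bc$ there are $v,w\in H$ with $u=vw$, $\theta(v)\in bB^\times$, $\theta(w)\in cB^\times$. For a domain $R$ with quotient field $K$: $(A:B)=\{x\in K\mid xB\subset A\}$; $\widehat R$ is the complete integral closure of $R$ in $K$; $\mathfrak X(R)$ is the set of minimal elements among the non-zero prime ideals; $\mathcal I(R)$ and $\mathcal I^*(R)$ are the semigroups of non-zero, respectively invertible, ideals of $R$ under ideal multiplication; $R$ is Mori if it satisfies the ascending chain condition on divisorial ideals (ideals $I=(R:(R:I))$); a non-zero ideal $I$ is stable if it is invertible as an ideal of the ring $(I:I)$. Theorem 5.9. Let $R$ be a one-dimensional Mori domain such that every $\mathfrak m\in\mathfrak X(R)$ is stable and satisfies $(R_{\mathfrak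 m}:\widehat{R_{\mathfrak m}})\neq\{0\}$. Then $\mathcal I(R)$ and $\mathcal I^*(R)$ are unit-cancellative and atomic, and the following hold. 1. The following statements are equivalent: (a) $\mathcal I(R)$ is transfer Krull; (b) $\mathcal I^*(R)$ is transfer Krull; (c) $\mathcal I^*(R)$ is half-factorial; (d) $\mathcal I(R)$ is half-factorial; (e) $\mathsf c(\mathcal I(R))\le 2$; (f) $\mathsf c(\mathcal I^*(R))\le 2$. If these conditions hold, then the map $\mathfrak X(\widehat R)\to\mathfrak X(R)$, $\mathfrak P\mapsto\mathfrak P\cap R$, is well defined and bijective. 2. If $\mathcal I(R)$ is not half-factorial, then $\gimel(\mathcal I(R))=2+\sup\Delta(\mathcal I(R))$. If $\mathcal I^*(R)$ is not half-factorial, then $\gimel(\mathcal I^*(R))=2+\sup\Delta(\mathcal I^*(R))$. -/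

import Mathlib

open scoped nonZeroDivisors

noncomputable section

namespace StableMori

universe u v

/-! ### Arithmetic of commutative monoids -/

section Monoids

variable (H : Type u) [CommMonoid H]

/-- `a = a * x` implies that `x` is a unit. -/
def IsUnitCancellative : Prop := ∀ a x : H, a = a * x → IsUnit x

/-- Every non-unit is a finite product of atoms. -/
def IsAtomicMonoid : Prop :=
  ∀ a : H, ¬ IsUnit a → ∃ s : Multiset H, (∀ x ∈ s, Irreducible x) ∧ s.prod = a

variable {H}

/-- The set `Z(a)` of factorizations of `a`: the finite multisets of atoms of the associated
reduced monoid whose product is the class of `a`. -/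
def factorizationSet (a : H) : Set (Multiset (Associates H)) :=
  {z | (∀ x ∈ z, Irreducible x) ∧ z.prod = Associates.mk a}

/-- The set of lengths `L(a)`; it is `{0}` if `a` is a unit. -/
def lengthSet (a : H) : Set ℕ := Multiset.card '' factorizationSet a

variable (H) in
/-- Atomic, and every set of lengths is a singleton. -/
def IsHalfFactorial : Prop := IsAtomicMonoid H ∧ ∀ a : H, ∃ k : ℕ, lengthSet a = {k}

/-- The set of distances of a set of non-negative integers. -/
def distances (A : Set ℕ) : Set ℕ :=
  {d | 0 < d ∧ ∃ a ∈ A, A ∩ Set.Icc a (a + d) = {a, a + d}}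

variable (H) in
/-- The set of distances `Δ(H)`. -/
def distanceSet : Set ℕ := ⋃ a : H, distances (lengthSet a)

variable (H) in
/-- `sup Δ(H)`, with `sup ∅ = 0`. -/
def supDelta : ℕ∞ := ⨆ d ∈ distanceSet H, (d : ℕ∞)

variable (H) in
/-- `ℷ(H)`: the supremum of `min (L \ {2})` over all sets of lengths `L` of `H` which contain `2`
and have more than one element, with `sup ∅ = 0`. -/
def daleth : ℕ∞ :=
  ⨆ (a : H) (_ : 2 ∈ lengthSet a ∧ (lengthSet a).Nontrivial),
    ((sInf (lengthSet a \ {2}) : ℕ) : ℕ∞)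

open Classical in
/-- The distance of two factorizations: the larger of the two lengths that remain when
the common part has been cancelled. -/
def factorizationDist (z z' : Multiset (Associates H)) : ℕ :=
  max (Multiset.card (z - z')) (Multiset.card (z' - z))

/-- Any two factorizations of `a` can be concatenated by an `N`-chain of factorizations of `a`. -/
def HasChains (a : H) (N : ℕ∞) : Prop :=
  ∀ z ∈ factorizationSet a, ∀ z' ∈ factorizationSet a,
    Relation.ReflTransGen
      (fun x y => x ∈ factorizationSet a ∧ y ∈ factorizationSet a ∧
        (factorizationDist x y : ℕ∞) ≤ N) z z'

/-- The catenary degree `c(a)` of an element. -/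
def elementCatenaryDegree (a : H) : ℕ∞ := sInf {N | HasChains a N}

variable (H) in
/-- The catenary degree `c(H)`. -/
def catenaryDegree : ℕ∞ := ⨆ a : H, elementCatenaryDegree a

/-- Transfer homomorphisms: `(T1)` says `B = θ(H) Bˣ` and `θ⁻¹(Bˣ) = Hˣ`, and `(T2)` says that
factorizations `θ(x) = b c` lift to `H` up to units of `B`. -/
structure IsTransferHom {B : Type v} [CommMonoid B] (θ : H →* B) : Prop where
  surj : ∀ b : B, ∃ x : H, Associated (θ x) b
  isUnit_iff : ∀ x : H, IsUnit (θ x) ↔ IsUnit x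
  lift : ∀ (x : H) (b c : B), θ x = b * c →
    ∃ y w : H, x = y * w ∧ Associated (θ y) b ∧ Associated (θ w) c

/-- For a cancellative monoid `B` with quotient group `q(B)` and `A ⊆ q(B)`, this is
`A⁻¹ = {z ∈ q(B) | zA ⊆ B}`. -/
def monoidInv (B : Type v) [CancelCommMonoid B] (A : Set (Algebra.GrothendieckGroup B)) :
    Set (Algebra.GrothendieckGroup B) :=
  {z | ∀ a ∈ A, z * a ∈ Set.range (Algebra.GrothendieckGroup.of (M := B))}

/-- Divisorial ideals (`v`-ideals) of a cancellative monoid. -/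
def IsMonoidDivisorial (B : Type v) [CancelCommMonoid B] (A : Set B) : Prop :=
  monoidInv B (monoidInv B (Algebra.GrothendieckGroup.of '' A)) =
    Algebra.GrothendieckGroup.of '' A

/-- The ascending chain condition on divisorial ideals. -/
def IsMoriMonoid (B : Type v) [CancelCommMonoid B] : Prop :=
  WellFoundedGT {A : Set B // IsMonoidDivisorial B A}

/-- `B` is equal to its complete integral closure. -/
def IsCompletelyIntegrallyClosedMonoid (B : Type v) [CancelCommMonoid B] : Prop :=
  ∀ x : Algebra.GrothendieckGroup B,
    (∃ c : B, ∀ n : ℕ, Algebra.GrothendieckGroup.of c * x ^ n ∈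
      Set.range (Algebra.GrothendieckGroup.of (M := B))) →
    x ∈ Set.range (Algebra.GrothendieckGroup.of (M := B))

/-- Krull monoids: completely integrally closed Mori monoids. -/
def IsKrullMonoid (B : Type v) [CancelCommMonoid B] : Prop :=
  IsCompletelyIntegrallyClosedMonoid B ∧ IsMoriMonoid B

variable (H) in
/-- `H` allows a transfer homomorphism to a Krull monoid. (Nothing is lost by taking `B` in the
universe of `H`: composing with `B → B_red` gives a transfer homomorphism onto a reduced Krull
monoid, which is a quotient of `H`.) -/
def IsTransferKrull : Prop :=
  ∃ (B : Type u) (_ : CancelCommMonoid B), IsKrullMonoid B ∧ ∃ θ : H →* B, IsTransferHom θ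

end Monoids

/-! ### Ideals of domains -/

section Domains

variable (R : Type u) [CommRing R]

/-- `𝔛(R)`: the set of minimal elements among the non-zero prime ideals of `R`. -/
def minimalNonzeroPrimes : Set (Ideal R) :=
  {P | Minimal (fun Q : Ideal R => Q.IsPrime ∧ Q ≠ ⊥) P}

variable {R}

/-- `I` is invertible (as a fractional ideal, in the total quotient ring `K` of `R`). -/
def IsInvertibleIdeal (K : Type v) [CommRing K] [Algebra R K] (I : Ideal R) : Prop :=
  IsUnit (I : FractionalIdeal R⁰ K)

section

variable (K : Type v) [Field K] [Algebra R K]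

/-- `I = (R : (R : I))`, colons being formed in the quotient field `K` of `R`. -/
def IsDivisorialIdeal (I : Ideal R) : Prop :=
  (1 : Submodule R K) / ((1 : Submodule R K) / IsLocalization.coeSubmodule K I) =
    IsLocalization.coeSubmodule K I

/-- The overring `(I : I) = {x ∈ K | xI ⊆ I}` of `R`. -/
def endoRing (I : Ideal R) : Subalgebra R K where
  carrier := {x | ∀ y ∈ IsLocalization.coeSubmodule K I, x * y ∈ IsLocalization.coeSubmodule K I}
  mul_mem' {a b} ha hb y hy := by
    rw [mul_assoc]
    exact ha _ (hb _ hy)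
  add_mem' {a b} ha hb y hy := by
    rw [add_mul]
    exact Submodule.add_mem _ (ha _ hy) (hb _ hy)
  algebraMap_mem' r y hy := by
    rw [← Algebra.smul_def]
    exact Submodule.smul_mem _ _ hy

/-- A non-zero ideal `I` is stable if it is invertible as an ideal of `(I : I)`; since
`I (I : I) = I`, the extension of `I` to the overring is `I` itself. -/
def IsStableIdeal (I : Ideal R) : Prop :=
  I ≠ ⊥ ∧ IsInvertibleIdeal K (I.map (algebraMap R (endoRing K I)))

variable (R) in
/-- The ascending chain condition on divisorial ideals, for a domain `R` with quotient field `K`. -/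
def IsMoriDomain : Prop := WellFoundedGT {I : Ideal R // IsDivisorialIdeal K I}

variable (R) in
/-- `(R : R̂) = {x ∈ K | x R̂ ⊆ R}`, where `R̂ ⊆ K` is the complete integral closure. -/
def completeConductor : Submodule R K :=
  (1 : Submodule R K) / Subalgebra.toSubmodule (completeIntegralClosure R K)

end

variable (R)
variable [IsDomain R]

/-- `𝓘(R)`: the monoid of non-zero ideals, with ideal multiplication. -/
def nonzeroIdeals : Submonoid (Ideal R) where
  carrier := {I | I ≠ ⊥}
  mul_mem' {_ _} ha hb := mul_ne_zero ha hb
  one_mem' := one_ne_zero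

/-- `𝓘*(R)`: the monoid of invertible ideals, with ideal multiplication. -/
def invertibleIdeals : Submonoid (Ideal R) where
  carrier := {I | IsInvertibleIdeal (FractionRing R) I}
  mul_mem' {a b} ha hb := by
    change IsUnit ((a * b : Ideal R) : FractionalIdeal R⁰ (FractionRing R))
    rw [FractionalIdeal.coeIdeal_mul]
    exact IsUnit.mul ha hb
  one_mem' := by
    change IsUnit ((1 : Ideal R) : FractionalIdeal R⁰ (FractionRing R))
    rw [Ideal.one_eq_top, FractionalIdeal.coeIdeal_top]
    exact isUnit_one

end Domains

end StableMori

end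

open StableMori

/-!
The hypotheses force the square of every maximal ideal `m` to be locally principal over `m`: there
is `α ∈ m` with `M ^ 2 = α M`, where `M` is the maximal ideal of `R_m`. Indeed, `m` is divisorial
(`IsStableIdeal.isDivisorial`), so the Mori property, which is used in the form `HasFiniteColons`,
passes from `R` to the overring `(M : M)` of `R_m`. The conductor condition makes all non-zero
primes of `(M : M)` contain `M`, so that `(M : M)` is semilocal (`finite_isMaximal`), and the
invertible ideal `M` of this ring is principal (`exists_sq_le_component`). Moreover every non-zero
element lies in only finitely many maximal ideals (`finite_of_isDivisorial`).

Hence every non-zero ideal is the product of its components at the maximal ideals, and every ideal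
contained in `m ^ 2` is divisible by the cancellable ideal `α R_m ∩ R`, which is an atom. So the
atoms are exactly the proper ideals `I` that are primary to some `m` and not contained in `m ^ 2`.
What matters for the arithmetic is recorded in `PrimarySystem`, which is available for all non-zero
ideals and for the invertible ones: `v m I` is the largest `k` with `I ⊆ m ^ k`, and
`size I`, the sum of these orders, is the largest length of a factorization of `I`.

* All lengths of `I` agree with `size I` for all `I` if and only if all `v m` are additive
  (`isHalfFactorial_iff`). In that case `size` is a transfer homomorphism to `ℕ`, and products of
  two atoms at `m` can be rewritten as `α` times an atom without changing the length, which leads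
  to chains of distance at most `2` between any two factorizations.
* If `θ` is a transfer homomorphism to a Krull monoid and `u` is an atom at `m`, then `α u ^ n` is
  divisible by `α ^ n` for all `n`. As the Krull monoid is completely integrally closed, `θ α`
  divides `θ u`, and it follows that the two are associated; so `θ` determines `v m`, which is
  therefore additive.
* If the catenary degree is at most `2`, then factorizations of a cancellable element that are
  neighbours in a chain have equal lengths. This gives additivity on invertible ideals. Since
  `v m I` is the least order of an element of `I`, additivity on principal ideals suffices
  (`idealOrder_mul_of_span`).
* If the orders are additive, then they define discrete valuations of the quotient field, and the
  complete integral closure of `R` consists of the elements with non-negative values; its primes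
  over `m` are therefore unique (`bijOn_comap`).
* In the other case, let `k < k + d` be adjacent lengths of `a`. A factorization of length `k` can
  be changed, without changing its length, until it contains two atoms `u`, `w` for which `u * w`
  has a length greater than `2` (`exists_pair_of_card_lt`). Every such length is at least `2 + d`,
  which gives the distance formula (`daleth_eq`).
-/

namespace StableMori

universe u v

/-! ### Monoids with a primary decomposition and multiplicity one -/

lemma irreducible_mk_iff {H : Type u} [CommMonoid H] [Subsingleton Hˣ] {a : H} :
    Irreducible (Associates.mk a) ↔ Irreducible a := by
  simp only [_root_.irreducible_iff, Associates.isUnit_mk, Associates.forall_associated,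
    Associates.mk_mul_mk, Associates.mk_injective.eq_iff]

/-- A commutative monoid `H` in which every element is a finite product of its components at the
points of `P`, and whose component at `p` looks like the monoid of ideals of a local domain whose
maximal ideal `M` satisfies `M² = αM`: `π p` is the projection to the component at `p`, `v p a` is
the largest `k` such that `a` lies in the `k`-th power of the maximal ideal at `p`, and `α p` is a
cancellable element of the component at `p` which divides every element of value at least `2`. -/
structure PrimarySystem (H : Type u) [CommMonoid H] (P : Type v) where
  π : P → H →* H
  v : P → H → ℕ
  α : P → H
  finite_supp : ∀ a, {p | π p a ≠ 1}.Finite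
  ext : ∀ a b, (∀ p, π p a = π p b) → a = b
  π_self : ∀ p a, π p (π p a) = π p a
  π_ne : ∀ p q a, p ≠ q → π p (π q a) = 1
  v_eq_zero : ∀ p a, v p a = 0 ↔ π p a = 1
  v_π : ∀ p a, v p (π p a) = v p a
  le_v_mul : ∀ p a b, v p a + v p b ≤ v p (a * b)
  v_α_mul : ∀ p a, v p (α p * a) = v p a + 1
  π_α : ∀ p, π p (α p) = α p
  α_cancel : ∀ p a b, α p * a = α p * b → a = b
  α_dvd : ∀ p a, 2 ≤ v p a → α p ∣ a

namespace PrimarySystem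

variable {H : Type u} [CommMonoid H] {P : Type v} (D : PrimarySystem H P)

lemma v_one (p : P) : D.v p 1 = 0 := (D.v_eq_zero p 1).2 (map_one _)

lemma v_α (p : P) : D.v p (D.α p) = 1 := by
  have := D.v_α_mul p 1
  rwa [mul_one, D.v_one] at this

lemma π_α_ne {p q : P} (h : p ≠ q) : D.π p (D.α q) = 1 := by
  rw [← D.π_α q, D.π_ne p q _ h]

lemma v_congr {p : P} {a b : H} (h : D.π p a = D.π p b) : D.v p a = D.v p b := by
  rw [← D.v_π, h, D.v_π]

lemma v_mul_of_π_eq_one {p : P} {a : H} (b : H) (h : D.π p a = 1) :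
    D.v p (a * b) = D.v p b := D.v_congr (by rw [map_mul, h, one_mul])

lemma v_supp_finite (a : H) : (Function.support fun p => D.v p a).Finite :=
  (D.finite_supp a).subset fun p hp h => hp ((D.v_eq_zero p a).2 h)

/-- The total value of an element. It is the largest length of a factorization. -/
noncomputable def size (a : H) : ℕ := ∑ᶠ p, D.v p a

lemma size_mul_le (a b : H) : D.size a + D.size b ≤ D.size (a * b) := by
  unfold size
  rw [← finsum_add_distrib (D.v_supp_finite a) (D.v_supp_finite b)]
  refine finsum_le_finsum' ?_ (D.v_supp_finite _) fun p => D.le_v_mul p a b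
  exact ((D.v_supp_finite a).union (D.v_supp_finite b)).subset (Function.support_add _ _)

lemma v_le_size (p : P) (a : H) : D.v p a ≤ D.size a :=
  single_le_finsum p (D.v_supp_finite a) fun _ => Nat.zero_le _

lemma size_one : D.size 1 = 0 := by
  simp [size, D.v_one]

lemma size_eq_zero {a : H} : D.size a = 0 ↔ a = 1 := by
  refine ⟨fun h => D.ext _ _ fun p => ?_, fun h => h ▸ D.size_one⟩
  rw [map_one]
  exact (D.v_eq_zero p a).1 (Nat.le_zero.1 (h ▸ D.v_le_size p a))

lemma size_eq_of_forall_add {a b c : H} (h : ∀ p, D.v p a = D.v p b + D.v p c) :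
    D.size a = D.size b + D.size c := by
  unfold size
  rw [← finsum_add_distrib (D.v_supp_finite b) (D.v_supp_finite c)]
  exact finsum_congr h

lemma size_π (p : P) (a : H) : D.size (D.π p a) = D.v p a := by
  unfold size
  rw [finsum_eq_single _ p, D.v_π]
  exact fun q hq => (D.v_eq_zero q _).2 (D.π_ne q p a hq)

lemma size_α (p : P) : D.size (D.α p) = 1 := by
  rw [← D.π_α, D.size_π, D.v_α]

lemma size_α_mul (p : P) (a : H) : D.size (D.α p * a) = D.size a + 1 := by
  rw [← D.size_α p, add_comm]
  refine D.size_eq_of_forall_add fun q => ?_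
  by_cases h : q = p
  · subst h
    rw [D.v_α_mul, D.v_α, add_comm]
  · rw [D.v_mul_of_π_eq_one _ (D.π_α_ne h), (D.v_eq_zero _ _).2 (D.π_α_ne h), zero_add]

lemma size_π_mul {p : P} {a b : H} (ha : D.π p a = a) (hb : D.π p b = 1) :
    D.size (a * b) = D.size a + D.size b := by
  refine D.size_eq_of_forall_add fun q => ?_
  by_cases h : q = p
  · subst h
    rw [mul_comm, D.v_mul_of_π_eq_one _ hb, (D.v_eq_zero _ _).2 hb, add_zero]
  · have h1 : D.π q a = 1 := by rw [← ha, D.π_ne _ _ _ h]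
    rw [D.v_mul_of_π_eq_one _ h1, (D.v_eq_zero _ _).2 h1, zero_add]

lemma isUnit_iff (D : PrimarySystem H P) {a : H} : IsUnit a ↔ a = 1 := by
  refine ⟨?_, fun h => h ▸ isUnit_one⟩
  rintro ⟨u, rfl⟩
  have := D.size_mul_le (u : H) (u⁻¹ : Hˣ)
  rw [Units.mul_inv, D.size_one] at this
  exact D.size_eq_zero.1 (by omega)

lemma eq_prod_π (a : H) : a = ∏ p ∈ (D.finite_supp a).toFinset, D.π p a := by
  classical
  refine D.ext _ _ fun q => ?_
  rw [map_prod]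
  by_cases hq : D.π q a = 1
  · rw [hq, Finset.prod_eq_one]
    intro p hp
    by_cases h : q = p
    · rw [← h, hq, map_one]
    · exact D.π_ne q p a h
  · rw [Finset.prod_eq_single q, D.π_self]
    · exact fun p _ hp => D.π_ne q p a hp.symm
    · intro h
      exact absurd ((D.finite_supp a).mem_toFinset.2 hq) h

/-- Splitting off the component at `p`. -/
lemma exists_eq_π_mul (p : P) (a : H) : ∃ c, a = D.π p a * c ∧ D.π p c = 1 := by
  classical
  by_cases hp : D.π p a = 1
  · exact ⟨a, by rw [hp, one_mul], hp⟩
  · refine ⟨∏ q ∈ (D.finite_supp a).toFinset.erase p, D.π q a, ?_, ?_⟩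
    · rw [Finset.mul_prod_erase _ (fun q => D.π q a) ((D.finite_supp a).mem_toFinset.2 hp)]
      exact D.eq_prod_π a
    · rw [map_prod]
      exact Finset.prod_eq_one fun q hq => D.π_ne p q a (Finset.ne_of_mem_erase hq).symm

lemma exists_π_ne_one {a : H} (h : a ≠ 1) : ∃ p, D.π p a ≠ 1 := by
  by_contra! hc
  exact h (D.ext _ _ fun p => by rw [hc, map_one])

lemma one_le_v {p : P} {a : H} (h : D.π p a ≠ 1) : 1 ≤ D.v p a :=
  Nat.one_le_iff_ne_zero.2 fun h' => h ((D.v_eq_zero p a).1 h')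

/-- Elements of value at least `2` at `p` are divisible by `α p`, and therefore are not atoms. -/
lemma irreducible_iff {a : H} : Irreducible a ↔ D.size a = 1 := by
  constructor
  · intro h
    obtain ⟨p, hp⟩ := D.exists_π_ne_one fun h1 => h.not_isUnit (D.isUnit_iff.2 h1)
    obtain ⟨c, hc, -⟩ := D.exists_eq_π_mul p a
    have hc1 : c = 1 := (h.isUnit_or_isUnit hc).elim
      (fun h' => absurd (D.isUnit_iff.1 h') hp) D.isUnit_iff.1
    rw [hc1, mul_one] at hc
    by_cases h2 : 2 ≤ D.v p a
    · obtain ⟨b, hb⟩ := D.α_dvd p a h2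
      have hb1 : b = 1 := by
        refine (h.isUnit_or_isUnit hb).elim (fun h' => ?_) D.isUnit_iff.1
        have := D.size_α p
        rw [D.isUnit_iff.1 h', D.size_one] at this
        omega
      rw [hb, hb1, mul_one, D.size_α]
    · have := D.one_le_v hp
      rw [hc, D.size_π]
      omega
  · intro h
    refine ⟨fun hu => ?_, fun b c hbc => ?_⟩
    · rw [D.isUnit_iff.1 hu, D.size_one] at h
      omega
    · have := D.size_mul_le b c
      rw [← hbc, h] at this
      rw [D.isUnit_iff, D.isUnit_iff, ← D.size_eq_zero, ← D.size_eq_zero]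
      omega

/-- Every atom lives at exactly one point. -/
lemma exists_π_eq_of_irreducible {a : H} (h : Irreducible a) :
    ∃ p, D.π p a = a ∧ D.v p a = 1 := by
  obtain ⟨p, hp⟩ := D.exists_π_ne_one fun h1 => h.not_isUnit (D.isUnit_iff.2 h1)
  obtain ⟨c, hc, -⟩ := D.exists_eq_π_mul p a
  have hc1 : c = 1 := (h.isUnit_or_isUnit hc).elim
    (fun h' => absurd (D.isUnit_iff.1 h') hp) D.isUnit_iff.1
  rw [hc1, mul_one] at hc
  exact ⟨p, hc.symm, by rw [← D.size_π, ← hc, D.irreducible_iff.1 h]⟩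

lemma irreducible_α (p : P) : Irreducible (D.α p) := D.irreducible_iff.2 (D.size_α p)

/-- An atom can be split off in such a way that the size drops by exactly one. -/
lemma exists_irreducible_mul {a : H} (h : a ≠ 1) :
    ∃ u c, Irreducible u ∧ a = u * c ∧ D.size a = D.size c + 1 := by
  obtain ⟨p, hp⟩ := D.exists_π_ne_one h
  by_cases h2 : 2 ≤ D.v p a
  · obtain ⟨b, hb⟩ := D.α_dvd p a h2
    exact ⟨_, b, D.irreducible_α p, hb, by rw [hb, D.size_α_mul]⟩
  · have h1 := D.one_le_v hp
    obtain ⟨c, hc, hc1⟩ := D.exists_eq_π_mul p a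
    have hs : D.size (D.π p a) = 1 := by rw [D.size_π]; omega
    refine ⟨_, c, D.irreducible_iff.2 hs, hc, ?_⟩
    conv_lhs => rw [hc]
    rw [D.size_π_mul (D.π_self p a) hc1, hs, add_comm]

/-- There is a factorization of length `size a`. -/
lemma exists_factorization (a : H) :
    ∃ z : Multiset H, (∀ x ∈ z, Irreducible x) ∧ z.prod = a ∧ Multiset.card z = D.size a := by
  induction hn : D.size a generalizing a with
  | zero => exact ⟨0, by simp, by simp [D.size_eq_zero.1 hn], by simp⟩
  | succ n ih =>
    obtain ⟨u, c, hu, rfl, hs⟩ := D.exists_irreducible_mul (a := a) fun h => by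
      rw [h, D.size_one] at hn
      omega
    obtain ⟨z, hz, hz', hzc⟩ := ih c (by omega)
    refine ⟨u ::ₘ z, ?_, by rw [Multiset.prod_cons, hz'], by rw [Multiset.card_cons, hzc]⟩
    simpa [hu] using hz

lemma card_le_size {z : Multiset H} (hz : ∀ x ∈ z, Irreducible x) :
    Multiset.card z ≤ D.size z.prod := by
  induction z using Multiset.induction with
  | empty => simp
  | cons u z ih =>
    have h1 := ih fun x hx => hz x (Multiset.mem_cons_of_mem hx)
    have h2 := D.irreducible_iff.1 (hz u (Multiset.mem_cons_self u z))
    have h3 := D.size_mul_le u z.prod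
    rw [Multiset.card_cons, Multiset.prod_cons]
    omega

lemma isUnitCancellative (D : PrimarySystem H P) : IsUnitCancellative H := fun a x h => by
  have := D.size_mul_le a x
  rw [← h] at this
  exact D.isUnit_iff.2 (D.size_eq_zero.1 (by omega))

lemma isAtomicMonoid (D : PrimarySystem H P) : IsAtomicMonoid H := fun a _ =>
  let ⟨z, hz, hz', _⟩ := D.exists_factorization a
  ⟨z, hz, hz'⟩

lemma subsingleton_units (D : PrimarySystem H P) : Subsingleton Hˣ :=
  ⟨fun a b => Units.ext ((D.isUnit_iff.1 a.isUnit).trans (D.isUnit_iff.1 b.isUnit).symm)⟩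

/-! ### Factorizations in a reduced monoid -/

lemma mem_factorizationSet (D : PrimarySystem H P) {a : H} {z : Multiset (Associates H)} :
    z ∈ factorizationSet a ↔
      ∃ y : Multiset H, (∀ x ∈ y, Irreducible x) ∧ y.prod = a ∧ y.map Associates.mk = z := by
  have := D.subsingleton_units
  constructor
  · rintro ⟨h1, h2⟩
    obtain ⟨y, rfl⟩ := Multiset.map_surjective_of_surjective Associates.mk_surjective z
    refine ⟨y, fun x hx =>
      StableMori.irreducible_mk_iff.1 (h1 _ (Multiset.mem_map_of_mem _ hx)), ?_, rfl⟩
    exact Associates.mk_injective (Associates.prod_mk.symm.trans h2)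
  · rintro ⟨y, h1, rfl, rfl⟩
    refine ⟨fun x hx => ?_, Associates.prod_mk⟩
    obtain ⟨w, hw, rfl⟩ := Multiset.mem_map.1 hx
    exact StableMori.irreducible_mk_iff.2 (h1 w hw)

lemma mem_lengthSet (D : PrimarySystem H P) {a : H} {k : ℕ} :
    k ∈ lengthSet a ↔
      ∃ y : Multiset H, (∀ x ∈ y, Irreducible x) ∧ y.prod = a ∧ Multiset.card y = k := by
  constructor
  · rintro ⟨z, hz, rfl⟩
    obtain ⟨y, h1, h2, rfl⟩ := D.mem_factorizationSet.1 hz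
    exact ⟨y, h1, h2, by simp⟩
  · rintro ⟨y, h1, h2, rfl⟩
    exact ⟨_, D.mem_factorizationSet.2 ⟨y, h1, h2, rfl⟩, by simp⟩

lemma size_mem_lengthSet (a : H) : D.size a ∈ lengthSet a :=
  D.mem_lengthSet.2 (D.exists_factorization a)

lemma le_size_of_mem_lengthSet {a : H} {k : ℕ} (h : k ∈ lengthSet a) : k ≤ D.size a := by
  obtain ⟨y, h1, rfl, rfl⟩ := D.mem_lengthSet.1 h
  exact D.card_le_size h1

lemma add_mem_lengthSet (D : PrimarySystem H P) {a b : H} {k l : ℕ} (hk : k ∈ lengthSet a)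
    (hl : l ∈ lengthSet b) :
    k + l ∈ lengthSet (a * b) := by
  obtain ⟨y, h1, rfl, rfl⟩ := D.mem_lengthSet.1 hk
  obtain ⟨z, h2, rfl, rfl⟩ := D.mem_lengthSet.1 hl
  refine D.mem_lengthSet.2 ⟨y + z, fun x hx => ?_, Multiset.prod_add _ _, Multiset.card_add _ _⟩
  exact (Multiset.mem_add.1 hx).elim (h1 x) (h2 x)

lemma mem_lengthSet_of_irreducible (D : PrimarySystem H P) {a : H} (ha : Irreducible a) :
    1 ∈ lengthSet a :=
  D.mem_lengthSet.2 ⟨{a}, by simpa using ha, by simp, by simp⟩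

/-- A set of lengths which contains `2` has no elements below `2`. -/
lemma two_le_of_two_mem_lengthSet (D : PrimarySystem H P) {a : H} (h : 2 ∈ lengthSet a) {k : ℕ}
    (hk : k ∈ lengthSet a) :
    2 ≤ k := by
  have h2 := D.le_size_of_mem_lengthSet h
  obtain ⟨y, h1, rfl, rfl⟩ := D.mem_lengthSet.1 hk
  by_contra! hlt
  have : Multiset.card y = 0 ∨ Multiset.card y = 1 := by omega
  rcases this with h0 | h0
  · rw [Multiset.card_eq_zero.1 h0, Multiset.prod_zero, D.size_one] at h2
    omega
  · obtain ⟨x, rfl⟩ := Multiset.card_eq_one.1 h0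
    rw [Multiset.prod_singleton, D.irreducible_iff.1 (h1 x (by simp))] at h2
    omega

/-! ### Half-factoriality -/

/-- The values are homomorphisms. -/
def IsAdditive : Prop := ∀ p a b, D.v p (a * b) = D.v p a + D.v p b

lemma isAdditive_of_size (h : ∀ a b, D.size (a * b) = D.size a + D.size b) : D.IsAdditive :=
  fun p a b => by rw [← D.size_π, map_mul, h, D.size_π, D.size_π]

variable {D} in
lemma IsAdditive.size_mul (h : D.IsAdditive) (a b : H) :
    D.size (a * b) = D.size a + D.size b :=
  D.size_eq_of_forall_add fun p => h p a b

variable {D} in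
lemma IsAdditive.card_eq (h : D.IsAdditive) {z : Multiset H} (hz : ∀ x ∈ z, Irreducible x) :
    Multiset.card z = D.size z.prod := by
  induction z using Multiset.induction with
  | empty => simp [D.size_one]
  | cons u z ih =>
    rw [Multiset.card_cons, Multiset.prod_cons, h.size_mul,
      ih fun x hx => hz x (Multiset.mem_cons_of_mem hx),
      D.irreducible_iff.1 (hz u (Multiset.mem_cons_self u z)), add_comm]

/-- `H` is half-factorial if and only if the values are homomorphisms. -/
lemma isHalfFactorial_iff : IsHalfFactorial H ↔ D.IsAdditive := by
  constructor
  · rintro ⟨-, h⟩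
    refine D.isAdditive_of_size fun a b => ?_
    obtain ⟨k, hk⟩ := h (a * b)
    have h1 := D.size_mem_lengthSet (a * b)
    have h2 := D.add_mem_lengthSet (D.size_mem_lengthSet a) (D.size_mem_lengthSet b)
    rw [hk] at h1 h2
    exact h1.trans h2.symm
  · refine fun h => ⟨D.isAtomicMonoid, fun a => ⟨D.size a, Set.ext fun k => ⟨fun hk => ?_, ?_⟩⟩⟩
    · obtain ⟨y, h1, rfl, rfl⟩ := D.mem_lengthSet.1 hk
      exact h.card_eq h1
    · rintro rfl
      exact D.size_mem_lengthSet a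

/-! ### Transfer homomorphisms to Krull monoids -/

/-- If `u` is a non-unit at `p`, then `α * u ^ n` is divisible by `α ^ n`. -/
lemma exists_α_mul_pow {p : P} {u : H} (hu : 1 ≤ D.v p u) (n : ℕ) :
    ∃ d, D.α p * u ^ n = D.α p ^ n * d ∧ 1 ≤ D.v p d := by
  induction n with
  | zero => exact ⟨D.α p, by simp, (D.v_α p).ge⟩
  | succ n ih =>
    obtain ⟨d, hd, hd1⟩ := ih
    have h2 := D.le_v_mul p u d
    obtain ⟨e, he⟩ := D.α_dvd p (u * d) (by omega)
    refine ⟨e, ?_, ?_⟩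
    · rw [pow_succ, ← mul_assoc, hd, mul_assoc, mul_comm d u, he, pow_succ, mul_assoc]
    · have := D.v_α_mul p e
      rw [← he] at this
      omega

section Transfer

variable {B : Type*} [CancelCommMonoid B] {θ : H →* B}

/-- The quotient `θ u / θ α` is almost integral, since `α * u ^ n` is divisible by `α ^ n`. -/
lemma dvd_of_isCompletelyIntegrallyClosed (hB : IsCompletelyIntegrallyClosedMonoid B)
    {p : P} {u : H} (hu : 1 ≤ D.v p u) : θ (D.α p) ∣ θ u := by
  let f := Algebra.GrothendieckGroup.of (M := B)
  have key := hB (f (θ u) / f (θ (D.α p))) ⟨θ (D.α p), fun n => ?_⟩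
  · obtain ⟨b, hb⟩ := key
    refine ⟨b, Algebra.GrothendieckGroup.of_injective ?_⟩
    rw [map_mul]
    exact (eq_div_iff_mul_eq'.1 hb).symm.trans (mul_comm _ _)
  · obtain ⟨d, hd, -⟩ := D.exists_α_mul_pow hu n
    refine ⟨θ d, ?_⟩
    rw [div_pow, mul_div_assoc', eq_div_iff_mul_eq', ← map_pow, ← map_pow, ← map_mul, ← map_mul,
      ← map_pow, ← map_pow, ← map_mul, ← map_mul, hd, mul_comm]

/-- A transfer homomorphism to a completely integrally closed monoid identifies all atoms at `p`
with `α p`, up to associates. -/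
lemma associated_of_irreducible (hB : IsCompletelyIntegrallyClosedMonoid B) (hθ : IsTransferHom θ)
    {p : P} {u : H} (hu : Irreducible u) (hup : 1 ≤ D.v p u) :
    Associated (θ u) (θ (D.α p)) := by
  obtain ⟨b, hb⟩ := D.dvd_of_isCompletelyIntegrallyClosed (θ := θ) hB hup
  obtain ⟨y, w, rfl, hy, hw⟩ := hθ.lift u _ _ hb
  have hy' : ¬ IsUnit y := fun h =>
    (D.irreducible_α p).not_isUnit ((hθ.isUnit_iff _).1 (hy.isUnit ((hθ.isUnit_iff _).2 h)))
  have hw' : w = 1 := D.isUnit_iff.1 ((hu.isUnit_or_isUnit rfl).resolve_left hy')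
  rwa [hw', mul_one]

/-- Up to associates, `θ` is determined by the values: strip off factors `α p` until an atom or `1`
remains. -/
lemma associated_θ_π (hB : IsCompletelyIntegrallyClosedMonoid B) (hθ : IsTransferHom θ)
    (p : P) (a : H) : Associated (θ (D.π p a)) (θ (D.α p) ^ D.v p a) := by
  induction hn : D.v p a using Nat.strong_induction_on generalizing a with
  | _ n ih =>
  by_cases h0 : n = 0
  · rw [h0, pow_zero, (D.v_eq_zero p a).1 (hn.trans h0), map_one]
  by_cases h1 : n = 1
  · rw [h1, pow_one]
    refine D.associated_of_irreducible hB hθ (D.irreducible_iff.2 ?_) ?_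
    · rw [D.size_π, hn, h1]
    · rw [D.v_π, hn, h1]
  obtain ⟨c, hc⟩ := D.α_dvd p (D.π p a) (by rw [D.v_π]; omega)
  have hcc : D.π p c = c := D.α_cancel p _ _ (by
    rw [← hc, ← D.π_self p a, hc, map_mul, D.π_α])
  have hv : D.v p a = D.v p c + 1 := by rw [← D.v_π, hc, D.v_α_mul]
  have := ih (D.v p c) (by omega) c rfl
  rw [hcc] at this
  have hn' : n = D.v p c + 1 := by omega
  rw [hc, map_mul, hn', pow_succ']
  exact this.mul_left _

lemma isAdditive_of_isTransferHom (D : PrimarySystem H P)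
    (hB : IsCompletelyIntegrallyClosedMonoid B)
    (hθ : IsTransferHom θ) : D.IsAdditive := by
  intro p a b
  have h1 := D.associated_θ_π hB hθ p (a * b)
  have h2 := (D.associated_θ_π hB hθ p a).mul_mul (D.associated_θ_π hB hθ p b)
  rw [← map_mul, ← map_mul, ← pow_add] at h2
  have h3 := h1.symm.trans h2
  have hnu : ¬ IsUnit (θ (D.α p)) := fun h =>
    (D.irreducible_α p).not_isUnit ((hθ.isUnit_iff _).1 h)
  -- different powers of the non-unit `θ α` are not associated, as `B` is cancellative
  have aux : ∀ m n : ℕ, m < n → ¬ Associated (θ (D.α p) ^ m) (θ (D.α p) ^ n) := by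
    rintro m n hmn ⟨w, hw⟩
    obtain ⟨k, rfl⟩ := Nat.exists_eq_add_of_lt hmn
    rw [add_assoc, pow_add] at hw
    have hk := mul_left_cancel hw
    exact hnu (isUnit_of_dvd_unit (dvd_pow_self _ k.succ_ne_zero) (hk ▸ w.isUnit))
  rcases lt_trichotomy (D.v p (a * b)) (D.v p a + D.v p b) with h | h | h
  · exact absurd h3 (aux _ _ h)
  · exact h
  · exact absurd h3.symm (aux _ _ h)

end Transfer

lemma isHalfFactorial_of_isTransferKrull (D : PrimarySystem H P) (h : IsTransferKrull H) :
    IsHalfFactorial H := by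
  obtain ⟨B, _, hB, θ, hθ⟩ := h
  exact D.isHalfFactorial_iff.2 (D.isAdditive_of_isTransferHom hB.1 hθ)

end PrimarySystem

/-! ### The monoid of natural numbers is Krull -/

/-- The multiplicative copy of `ℕ` in an arbitrary universe. -/
abbrev MulNat : Type u := ULift.{u} (Multiplicative ℕ)

namespace MulNat

/-- The natural number `n` as an element of the multiplicative monoid. -/
def ofNat (n : ℕ) : MulNat.{u} := ⟨Multiplicative.ofAdd n⟩

/-- The underlying natural number. -/
def toNat (x : MulNat.{u}) : ℕ := Multiplicative.toAdd x.down

@[simp] lemma ofNat_toNat (x : MulNat.{u}) : ofNat (toNat x) = x := rfl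

@[simp] lemma toNat_ofNat (n : ℕ) : toNat (ofNat.{u} n) = n := rfl

@[simp] lemma toNat_mul (x y : MulNat.{u}) : toNat (x * y) = toNat x + toNat y := rfl

@[simp] lemma toNat_pow (x : MulNat.{u}) (n : ℕ) : toNat (x ^ n) = n * toNat x := by
  induction n with
  | zero => rw [pow_zero, zero_mul]; rfl
  | succ n ih => rw [pow_succ, toNat_mul, ih, Nat.succ_mul]

lemma toNat_injective : Function.Injective toNat.{u} := fun x y h => by
  rw [← ofNat_toNat x, h, ofNat_toNat]

lemma dvd_of_le {x y : MulNat.{u}} (h : toNat x ≤ toNat y) : ∃ z, y = x * z :=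
  ⟨ofNat (toNat y - toNat x), toNat_injective (by simp; omega)⟩

lemma isUnit_iff {x : MulNat.{u}} : IsUnit x ↔ toNat x = 0 := by
  constructor
  · rintro ⟨w, rfl⟩
    have : toNat ((w : MulNat.{u}) * (w⁻¹ : MulNat.{u}ˣ)) = 0 := by rw [Units.mul_inv]; rfl
    rw [toNat_mul] at this
    omega
  · intro h
    have : x = 1 := toNat_injective h
    exact this ▸ isUnit_one

instance : CancelCommMonoid MulNat.{u} :=
  { (inferInstance : CommMonoid MulNat.{u}) with
    mul_left_cancel := fun a b c h => toNat_injective (by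
      have := congrArg toNat h
      simp only [toNat_mul] at this
      omega) }

open Algebra.GrothendieckGroup

lemma mul_mem_of_isMonoidDivisorial {A : Set MulNat.{u}} (hA : IsMonoidDivisorial _ A)
    {a : MulNat.{u}} (ha : a ∈ A) (b : MulNat.{u}) : a * b ∈ A := by
  have h : of (a * b) ∈ of '' A := by
    rw [← hA]
    intro z hz
    obtain ⟨c, hc⟩ := hz (of a) ⟨a, ha, rfl⟩
    exact ⟨b * c, by rw [map_mul, hc, map_mul]; ac_rfl⟩
  obtain ⟨c, hc, hcb⟩ := h
  rwa [of_injective hcb] at hc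

/-- Divisorial ideals of `ℕ` are up-sets, and these are ordered by their least elements. -/
lemma isMoriMonoid : IsMoriMonoid MulNat.{u} := by
  unfold IsMoriMonoid
  rw [WellFoundedGT, isWellFounded_iff, WellFounded.wellFounded_iff_has_min]
  rintro S ⟨A₀, hA₀⟩
  by_cases hne : ∃ n, ∃ A ∈ S, ofNat n ∈ (A : Set MulNat.{u})
  · classical
    obtain ⟨A, hA, hnA⟩ := Nat.find_spec hne
    refine ⟨A, hA, fun B hB hAB => ?_⟩
    refine hAB.not_ge fun x hx => ?_
    have hle : Nat.find hne ≤ toNat x := Nat.find_min' hne ⟨B, hB, by rwa [ofNat_toNat]⟩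
    obtain ⟨z, rfl⟩ := dvd_of_le (x := ofNat (Nat.find hne)) (y := x) hle
    exact mul_mem_of_isMonoidDivisorial A.2 hnA z
  · refine ⟨A₀, hA₀, fun B hB hAB => ?_⟩
    exact hAB.not_ge fun x hx => absurd ⟨toNat x, B, hB, by rwa [ofNat_toNat]⟩ hne

lemma isCompletelyIntegrallyClosedMonoid : IsCompletelyIntegrallyClosedMonoid MulNat.{u} := by
  rintro x ⟨c, hc⟩
  obtain ⟨⟨a, b, hb⟩, hab⟩ := (Localization.monoidOf (⊤ : Submonoid MulNat.{u})).surj x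
  obtain rfl : x = of a / of b := eq_div_of_mul_eq' hab
  have hle : toNat b ≤ toNat a := by
    by_contra! hlt
    obtain ⟨d, hd⟩ := hc (toNat c + 1)
    rw [div_pow, mul_div_assoc', eq_div_iff_mul_eq', ← map_pow, ← map_pow, ← map_mul,
      ← map_mul] at hd
    have := congrArg toNat (of_injective hd)
    simp only [toNat_mul, toNat_pow] at this
    nlinarith
  obtain ⟨z, rfl⟩ := dvd_of_le hle
  exact ⟨z, by rw [map_mul, mul_div_cancel_left]⟩

lemma isKrullMonoid : IsKrullMonoid MulNat.{u} :=
  ⟨isCompletelyIntegrallyClosedMonoid, isMoriMonoid⟩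

end MulNat

namespace PrimarySystem

variable {H : Type u} [CommMonoid H] {P : Type v} (D : PrimarySystem H P)

/-- Decompositions of `size x` as a sum lift to factorizations of `x`, up to an inequality, which
is an equality in the additive case. -/
lemma exists_eq_mul_of_size_eq {x : H} {k l : ℕ} (h : D.size x = k + l) :
    ∃ y w, x = y * w ∧ D.size w = l ∧ k ≤ D.size y := by
  induction k generalizing x with
  | zero => exact ⟨1, x, (one_mul x).symm, by omega, Nat.zero_le _⟩
  | succ k ih =>
    obtain ⟨u, c, hu, rfl, hs⟩ := D.exists_irreducible_mul (a := x) fun h' => by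
      rw [h', D.size_one] at h
      omega
    obtain ⟨y, w, rfl, hw, hy⟩ := ih (x := c) (by omega)
    refine ⟨u * y, w, (mul_assoc u y w).symm, hw, ?_⟩
    have := D.size_mul_le u y
    rw [D.irreducible_iff.1 hu] at this
    omega

/-- If all values are additive, then the length is a transfer homomorphism to `ℕ`. -/
lemma isTransferKrull_of_isAdditive (h : D.IsAdditive) (p : P) : IsTransferKrull H := by
  refine ⟨MulNat.{u}, inferInstance, MulNat.isKrullMonoid,
    { toFun := fun a => MulNat.ofNat (D.size a)
      map_one' := by rw [D.size_one]; rfl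
      map_mul' := fun a b => MulNat.toNat_injective (h.size_mul a b) }, ?_, ?_, ?_⟩
  · intro b
    refine ⟨D.α p ^ MulNat.toNat b, Associated.of_eq (MulNat.toNat_injective ?_)⟩
    change D.size (D.α p ^ MulNat.toNat b) = MulNat.toNat b
    induction MulNat.toNat b with
    | zero => rw [pow_zero, D.size_one]
    | succ n ih => rw [pow_succ', D.size_α_mul, ih]
  · intro x
    rw [MulNat.isUnit_iff, D.isUnit_iff]
    exact D.size_eq_zero
  · intro x b c hx
    have hx' : D.size x = MulNat.toNat b + MulNat.toNat c := congrArg MulNat.toNat hx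
    obtain ⟨y, w, rfl, hw, -⟩ := D.exists_eq_mul_of_size_eq hx'
    rw [h.size_mul] at hx'
    exact ⟨y, w, rfl, Associated.of_eq (MulNat.toNat_injective (show D.size y = _ by omega)),
      Associated.of_eq (MulNat.toNat_injective hw)⟩

/-! ### The catenary degree -/

lemma factorizationDist_add_le {A : Type u} [CommMonoid A] (x y y' : Multiset (Associates A)) :
    factorizationDist (x + y) (x + y') ≤ max (Multiset.card y) (Multiset.card y') := by
  classical
  unfold factorizationDist
  rw [add_tsub_add_eq_tsub_left, add_tsub_add_eq_tsub_left]
  exact max_le_max (Multiset.card_le_card tsub_le_self) (Multiset.card_le_card tsub_le_self)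

/-- One step between two factorizations: at most two atoms are replaced by at most two atoms. -/
def Step (z z' : Multiset H) : Prop :=
  (∀ u ∈ z, Irreducible u) ∧ (∀ u ∈ z', Irreducible u) ∧ z.prod = z'.prod ∧
    ∃ x y y', z = x + y ∧ z' = x + y' ∧ Multiset.card y ≤ 2 ∧ Multiset.card y' ≤ 2

lemma Step.symm {z z' : Multiset H} : Step z z' → Step z' z := by
  rintro ⟨h1, h2, h3, x, y, y', h4, h5, h6, h7⟩
  exact ⟨h2, h1, h3.symm, x, y', y, h5, h4, h7, h6⟩

lemma Step.cons {z z' : Multiset H} {u : H} (hu : Irreducible u) (h : Step z z') :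
    Step (u ::ₘ z) (u ::ₘ z') := by
  obtain ⟨h1, h2, h3, x, y, y', rfl, rfl, h6, h7⟩ := h
  refine ⟨?_, ?_, by rw [Multiset.prod_cons, h3, Multiset.prod_cons],
    u ::ₘ x, y, y', by simp, by simp, h6, h7⟩
  · exact fun w hw => (Multiset.mem_cons.1 hw).elim (fun h => h ▸ hu) (h1 w)
  · exact fun w hw => (Multiset.mem_cons.1 hw).elim (fun h => h ▸ hu) (h2 w)

lemma reflTransGen_step_symm {z z' : Multiset H} (h : Relation.ReflTransGen Step z z') :
    Relation.ReflTransGen Step z' z := by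
  induction h with
  | refl => exact .refl
  | tail _ h ih => exact (Relation.ReflTransGen.single h.symm).trans ih

lemma reflTransGen_step_cons {z z' : Multiset H} {u : H} (hu : Irreducible u)
    (h : Relation.ReflTransGen Step z z') :
    Relation.ReflTransGen Step (u ::ₘ z) (u ::ₘ z') := by
  induction h with
  | refl => exact .refl
  | tail _ h ih => exact ih.tail (h.cons hu)

/-- A product of two atoms at `p` is `α p` times an element at `p`. -/
lemma exists_mul_eq_α_mul {p : P} {u w : H} (hu : D.π p u = u) (hu1 : D.v p u = 1)
    (hw : D.π p w = w) (hw1 : D.v p w = 1) :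
    ∃ d, u * w = D.α p * d ∧ D.π p d = d ∧ D.size (u * w) = D.size d + 1 := by
  have h := D.le_v_mul p u w
  obtain ⟨d, hd⟩ := D.α_dvd p (u * w) (by omega)
  refine ⟨d, hd, D.α_cancel p _ _ ?_, by rw [hd, D.size_α_mul]⟩
  calc D.α p * D.π p d = D.π p (D.α p * d) := by rw [map_mul, D.π_α]
    _ = D.α p * d := by rw [← hd, map_mul, hu, hw]

/-- A factorization of `a` contains an atom at each point where `a` has positive value. -/
lemma exists_atom_of_v_pos {p : P} {z : Multiset H} (hz : ∀ x ∈ z, Irreducible x)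
    (h : D.π p z.prod ≠ 1) :
    ∃ u y, z = u ::ₘ y ∧ D.π p u = u ∧ D.v p u = 1 := by
  obtain ⟨u, hu, hup⟩ : ∃ u ∈ z, D.π p u ≠ 1 := by
    by_contra! hc
    refine h ?_
    rw [map_multiset_prod]
    refine Multiset.prod_eq_one fun x hx => ?_
    obtain ⟨w, hw, rfl⟩ := Multiset.mem_map.1 hx
    exact hc w hw
  obtain ⟨y, rfl⟩ := Multiset.exists_cons_of_mem hu
  obtain ⟨q, hq, hq1⟩ := D.exists_π_eq_of_irreducible (hz u (Multiset.mem_cons_self u y))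
  have hpq : p = q := by
    by_contra hne
    rw [← hq, D.π_ne _ _ _ hne] at hup
    exact hup rfl
  subst hpq
  exact ⟨u, y, rfl, hq, hq1⟩

variable {D} in
/-- If the value of the product at `p` is at least `2`, then one step makes `α p` appear. -/
lemma IsAdditive.exists_chain_α (h : D.IsAdditive) {p : P} {z : Multiset H}
    (hz : ∀ x ∈ z, Irreducible x) (hp : 2 ≤ D.v p z.prod) :
    ∃ y, (∀ x ∈ y, Irreducible x) ∧ (D.α p ::ₘ y).prod = z.prod ∧
      Relation.ReflTransGen Step z (D.α p ::ₘ y) := by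
  obtain ⟨u, y, rfl, hu, hu1⟩ := D.exists_atom_of_v_pos (p := p) hz fun h' => by
    rw [(D.v_eq_zero p _).2 h'] at hp
    omega
  have hy : ∀ x ∈ y, Irreducible x := fun x hx => hz x (Multiset.mem_cons_of_mem hx)
  rw [Multiset.prod_cons, h] at hp
  obtain ⟨w, x, rfl, hw, hw1⟩ := D.exists_atom_of_v_pos (p := p) hy fun h' => by
    rw [(D.v_eq_zero p _).2 h'] at hp
    omega
  obtain ⟨d, hd, -, hds⟩ := D.exists_mul_eq_α_mul hu hu1 hw hw1
  have hd1 : Irreducible d := by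
    rw [D.irreducible_iff]
    rw [h.size_mul, D.irreducible_iff.1 (hz u (by simp)), D.irreducible_iff.1 (hz w (by simp))]
      at hds
    omega
  have hx : ∀ t ∈ x, Irreducible t := fun t ht => hy t (Multiset.mem_cons_of_mem ht)
  have hdx : ∀ t ∈ d ::ₘ x, Irreducible t := fun t ht =>
    (Multiset.mem_cons.1 ht).elim (fun e => e ▸ hd1) (hx t)
  have hprod : (D.α p ::ₘ d ::ₘ x).prod = (u ::ₘ w ::ₘ x).prod := by
    simp only [Multiset.prod_cons, ← mul_assoc, hd]
  refine ⟨d ::ₘ x, hdx, hprod, .single ⟨hz, ?_, hprod.symm, x, {u, w}, {D.α p, d}, ?_, ?_,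
    by simp, by simp⟩⟩
  · exact fun t ht => (Multiset.mem_cons.1 ht).elim (fun e => e ▸ D.irreducible_α p) (hdx t)
  · rw [add_comm]; simp
  · rw [add_comm]; simp

variable {D} in
/-- In the half-factorial case any two factorizations of an element are joined by steps. -/
lemma IsAdditive.reflTransGen_step (h : D.IsAdditive) {z z' : Multiset H}
    (hz : ∀ x ∈ z, Irreducible x) (hz' : ∀ x ∈ z', Irreducible x) (hzz : z.prod = z'.prod) :
    Relation.ReflTransGen Step z z' := by
  induction hn : D.size z.prod generalizing z z' with
  | zero =>
    have h1 := h.card_eq hz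
    have h2 := h.card_eq hz'
    rw [← hzz, hn] at h2
    rw [hn] at h1
    rw [Multiset.card_eq_zero.1 h1, Multiset.card_eq_zero.1 h2]
  | succ n ih =>
    obtain ⟨p, hp⟩ := D.exists_π_ne_one (a := z.prod) fun h' => by
      rw [h', D.size_one] at hn
      omega
    by_cases h2 : 2 ≤ D.v p z.prod
    · obtain ⟨y, hy, hyp, hyc⟩ := h.exists_chain_α hz h2
      obtain ⟨y', hy', hyp', hyc'⟩ := h.exists_chain_α hz' (hzz ▸ h2)
      rw [Multiset.prod_cons] at hyp hyp'
      have hyy : y.prod = y'.prod := D.α_cancel p _ _ (by rw [hyp, hyp', hzz])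
      have hs : D.size y.prod = n := by
        rw [← hyp, D.size_α_mul] at hn
        omega
      exact (hyc.trans (reflTransGen_step_cons (D.irreducible_α p) (ih hy hy' hyy hs))).trans
        (reflTransGen_step_symm hyc')
    · obtain ⟨u, y, rfl, hu, hu1⟩ := D.exists_atom_of_v_pos hz hp
      obtain ⟨u', y', rfl, hu', hu1'⟩ := D.exists_atom_of_v_pos hz' (hzz ▸ hp)
      rw [Multiset.prod_cons] at hn h2 hp hzz
      rw [Multiset.prod_cons] at hzz
      have hpy : D.π p y.prod = 1 := (D.v_eq_zero p _).1 (by rw [h, hu1] at h2; omega)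
      have hpy' : D.π p y'.prod = 1 := (D.v_eq_zero p _).1 (by rw [hzz, h, hu1'] at h2; omega)
      have huu : u = u' := by
        have := congrArg (D.π p) hzz
        rwa [map_mul, map_mul, hpy, hpy', mul_one, mul_one, hu, hu'] at this
      subst huu
      have hyy : y.prod = y'.prod := D.ext _ _ fun q => by
        by_cases hq : q = p
        · rw [hq, hpy, hpy']
        · have := congrArg (D.π q) hzz
          rwa [map_mul, map_mul, ← hu, D.π_ne _ _ _ hq, one_mul, one_mul] at this
      have hui := hz u (by simp)
      refine reflTransGen_step_cons hui (ih (fun x hx => hz x (Multiset.mem_cons_of_mem hx))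
        (fun x hx => hz' x (Multiset.mem_cons_of_mem hx)) hyy ?_)
      rw [D.size_π_mul hu hpy, D.irreducible_iff.1 hui] at hn
      omega

variable {D} in
lemma IsAdditive.catenaryDegree_le (h : D.IsAdditive) : catenaryDegree H ≤ 2 := by
  refine iSup_le fun a => sInf_le fun z hz z' hz' => ?_
  obtain ⟨y, h1, h2, rfl⟩ := D.mem_factorizationSet.1 hz
  obtain ⟨y', h1', h2', rfl⟩ := D.mem_factorizationSet.1 hz'
  have hc := h.reflTransGen_step h1 h1' (h2.trans h2'.symm)
  clear hz hz' h1 h1' h2'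
  induction hc with
  | refl => exact .refl
  | @tail b c hbc hstep ih =>
    have hb : b.prod = a := by
      clear ih hstep
      induction hbc with
      | refl => exact h2
      | tail _ hs ih => exact hs.2.2.1.symm.trans ih
    obtain ⟨g1, g2, g3, x, y, y', rfl, rfl, g6, g7⟩ := hstep
    refine ih.tail ⟨D.mem_factorizationSet.2 ⟨_, g1, hb, rfl⟩,
      D.mem_factorizationSet.2 ⟨_, g2, g3.symm.trans hb, rfl⟩, ?_⟩
    rw [Multiset.map_add, Multiset.map_add]
    refine le_trans (Nat.cast_le.2 (factorizationDist_add_le _ _ _)) ?_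
    rw [Multiset.card_map, Multiset.card_map]
    exact_mod_cast max_le g6 g7

lemma hasChains_two_of_catenaryDegree_le (h : catenaryDegree H ≤ 2) (a : H) : HasChains a 2 := by
  have h1 : elementCatenaryDegree a ≤ 2 := (le_iSup _ a).trans h
  -- the infimum that defines the catenary degree of `a` is attained, since `ℕ∞` is well-ordered
  have hne : {N | HasChains a N}.Nonempty :=
    ⟨⊤, fun z hz z' hz' => .single ⟨hz, hz', le_top⟩⟩
  have h2 : HasChains a (elementCatenaryDegree a) := csInf_mem hne
  intro z hz z' hz'
  refine Relation.ReflTransGen.mono ?_ _ _ (h2 z hz z' hz')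
  exact fun x y hxy => ⟨hxy.1, hxy.2.1, hxy.2.2.trans h1⟩

/-- If two factorizations of a cancellable element have distance at most `2`, then they have the
same length: after cancellation, a product of two atoms would otherwise be an atom or `1`. -/
lemma card_eq_of_factorizationDist_le (D : PrimarySystem H P) {a : H}
    (ha : ∀ b c, a * b = a * c → b = c) {z z' : Multiset (Associates H)}
    (hz : z ∈ factorizationSet a) (hz' : z' ∈ factorizationSet a)
    (hd : factorizationDist z z' ≤ 2) : Multiset.card z = Multiset.card z' := by
  classical
  have := D.subsingleton_units
  obtain ⟨y, h1, h2, rfl⟩ := D.mem_factorizationSet.1 hz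
  obtain ⟨y', h1', h2', rfl⟩ := D.mem_factorizationSet.1 hz'
  have hd' : Multiset.card (y - y') ≤ 2 ∧ Multiset.card (y' - y) ≤ 2 := by
    unfold factorizationDist at hd
    have hsub : ∀ s t : Multiset H, Multiset.card (s - t) ≤
        Multiset.card (s.map Associates.mk - t.map Associates.mk) := fun s t => by
      have hs : s.map Associates.mk - t.map Associates.mk = (s - t).map Associates.mk := by
        ext x
        obtain ⟨x, rfl⟩ := Associates.mk_surjective x
        rw [Multiset.count_sub, Multiset.count_map_eq_count' _ _ Associates.mk_injective,
          Multiset.count_map_eq_count' _ _ Associates.mk_injective,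
          Multiset.count_map_eq_count' _ _ Associates.mk_injective, Multiset.count_sub]
      rw [hs, Multiset.card_map]
    have e1 := hsub y y'
    have e2 := hsub y' y
    constructor
    · refine e1.trans (le_trans ?_ (le_trans (le_max_left _ _) hd))
      exact le_of_eq (by congr!)
    · refine e2.trans (le_trans ?_ (le_trans (le_max_right _ _) hd))
      exact le_of_eq (by congr!)
  have hy : y ∩ y' + (y - y') = y := by
    rw [add_comm, Multiset.sub_add_inter]
  have hy' : y ∩ y' + (y' - y) = y' := by
    rw [add_comm, Multiset.inter_comm, Multiset.sub_add_inter]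
  have hprod : (y - y').prod = (y' - y).prod := by
    refine ha _ _ ?_
    have hx : (y ∩ y').prod * (y - y').prod = a := by rw [← Multiset.prod_add, hy, h2]
    have hx' : (y ∩ y').prod * (y' - y).prod = a := by rw [← Multiset.prod_add, hy', h2']
    calc a * (y - y').prod = ((y ∩ y').prod * (y' - y).prod) * (y - y').prod := by rw [hx']
      _ = ((y ∩ y').prod * (y - y').prod) * (y' - y).prod := mul_right_comm _ _ _
      _ = a * (y' - y).prod := by rw [hx]
  have hi : ∀ x ∈ y - y', Irreducible x := fun x hx => h1 x (Multiset.mem_of_le tsub_le_self hx)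
  have hi' : ∀ x ∈ y' - y, Irreducible x := fun x hx => h1' x (Multiset.mem_of_le tsub_le_self hx)
  have key : Multiset.card (y - y') = Multiset.card (y' - y) := by
    have aux : ∀ s t : Multiset H, (∀ x ∈ s, Irreducible x) → (∀ x ∈ t, Irreducible x) →
        s.prod = t.prod → Multiset.card t ≤ 2 → ¬ Multiset.card s < Multiset.card t := by
      intro s t hs ht hst ht2 hlt
      have l1 : Multiset.card t ∈ lengthSet t.prod := D.mem_lengthSet.2 ⟨t, ht, rfl, rfl⟩
      have l2 : Multiset.card s ∈ lengthSet t.prod := D.mem_lengthSet.2 ⟨s, hs, hst, rfl⟩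
      by_cases h2 : Multiset.card t = 2
      · rw [h2] at l1
        have := D.two_le_of_two_mem_lengthSet l1 l2
        omega
      · have hs0 : Multiset.card s = 0 := by omega
        have := D.le_size_of_mem_lengthSet l1
        rw [← hst, Multiset.card_eq_zero.1 hs0, Multiset.prod_zero, D.size_one] at this
        omega
    have a1 := aux _ _ hi hi' hprod hd'.2
    have a2 := aux _ _ hi' hi hprod.symm hd'.1
    omega
  rw [Multiset.card_map, Multiset.card_map, ← hy, Multiset.card_add, key, ← Multiset.card_add, hy']

/-- If the catenary degree is at most `2`, then all factorizations of a cancellable element have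
the same length. -/
lemma eq_size_of_catenaryDegree_le (h : catenaryDegree H ≤ 2) {a : H}
    (ha : ∀ b c, a * b = a * c → b = c) {k : ℕ} (hk : k ∈ lengthSet a) : k = D.size a := by
  obtain ⟨z, hz, rfl⟩ := hk
  obtain ⟨z', hz', hs⟩ := D.size_mem_lengthSet a
  rw [← hs]
  have hc := hasChains_two_of_catenaryDegree_le h a z hz z' hz'
  clear hs hz'
  induction hc with
  | refl => rfl
  | tail _ h ih =>
    exact ih.trans (D.card_eq_of_factorizationDist_le ha h.1 h.2.1 (by exact_mod_cast h.2.2))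

/-- The lengths `size a + size b` and `size (a * b)` of `a * b` agree. -/
lemma size_mul_of_catenaryDegree_le (h : catenaryDegree H ≤ 2) {a b : H}
    (hab : ∀ x y, a * b * x = a * b * y → x = y) : D.size (a * b) = D.size a + D.size b :=
  (D.eq_size_of_catenaryDegree_le h hab
    (D.add_mem_lengthSet (D.size_mem_lengthSet a) (D.size_mem_lengthSet b))).symm

/-! ### The distance formula -/

/-- If the product of a factorization allows a longer one, then, after a change which keeps the
length, the factorization contains two atoms whose product allows a factorization of length greater
than `2`: as long as this is not the case, products of two atoms at `p` can be replaced by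
`α p` times an atom. -/
lemma exists_pair_of_card_lt {z : Multiset H} (hz : ∀ x ∈ z, Irreducible x)
    (h : Multiset.card z < D.size z.prod) :
    ∃ u w x, (∀ t ∈ u ::ₘ w ::ₘ x, Irreducible t) ∧ (u ::ₘ w ::ₘ x).prod = z.prod ∧
      Multiset.card x + 2 = Multiset.card z ∧ 2 < D.size (u * w) := by
  induction hn : Multiset.card z generalizing z with
  | zero =>
    rw [Multiset.card_eq_zero.1 hn, Multiset.prod_zero, D.size_one] at h
    omega
  | succ n ih =>
    have hcons : ∀ (t : H) (y : Multiset H), Irreducible t → (∀ x ∈ y, Irreducible x) →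
        Multiset.card y = n → n < D.size y.prod → t * y.prod = z.prod →
        ∃ u w x, (∀ t ∈ u ::ₘ w ::ₘ x, Irreducible t) ∧ (u ::ₘ w ::ₘ x).prod = z.prod ∧
          Multiset.card x + 2 = n + 1 ∧ 2 < D.size (u * w) := by
      intro t y ht hy hyn hlt htz
      obtain ⟨u, w, x, g1, g2, g3, g4⟩ := ih hy (hyn ▸ hlt) hyn
      refine ⟨u, w, t ::ₘ x, ?_, ?_, by rw [Multiset.card_cons]; omega, g4⟩
      · intro s hs
        rw [Multiset.cons_swap w, Multiset.cons_swap u] at hs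
        exact (Multiset.mem_cons.1 hs).elim (fun e => e ▸ ht) (g1 s)
      · rw [Multiset.cons_swap w, Multiset.cons_swap u, Multiset.prod_cons, g2, htz]
    obtain ⟨u, hu⟩ : ∃ u, u ∈ z := Multiset.card_pos_iff_exists_mem.1 (by omega)
    obtain ⟨y, rfl⟩ := Multiset.exists_cons_of_mem hu
    have hui := hz u hu
    have hy : ∀ x ∈ y, Irreducible x := fun x hx => hz x (Multiset.mem_cons_of_mem hx)
    rw [Multiset.card_cons] at hn h
    rw [Multiset.prod_cons] at h
    obtain ⟨p, hp, hp1⟩ := D.exists_π_eq_of_irreducible hui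
    by_cases hpy : D.π p y.prod = 1
    · rw [D.size_π_mul hp hpy, D.irreducible_iff.1 hui] at h
      exact hcons u y hui hy (by omega) (by omega) (Multiset.prod_cons u y).symm
    · obtain ⟨w, x, rfl, hw, hw1⟩ := D.exists_atom_of_v_pos hy hpy
      by_cases h2 : 2 < D.size (u * w)
      · refine ⟨u, w, x, hz, rfl, ?_, h2⟩
        rw [Multiset.card_cons] at hn
        omega
      · obtain ⟨d, hd, -, hds⟩ := D.exists_mul_eq_α_mul hp hp1 hw hw1
        have hwi := hy w (by simp)
        have h3 := D.size_mul_le u w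
        rw [D.irreducible_iff.1 hui, D.irreducible_iff.1 hwi] at h3
        have hdi : Irreducible d := D.irreducible_iff.2 (by omega)
        have hprod : u * (w ::ₘ x).prod = D.α p * (d ::ₘ x).prod := by
          rw [Multiset.prod_cons, Multiset.prod_cons, ← mul_assoc, ← mul_assoc, hd]
        rw [hprod, D.size_α_mul] at h
        rw [Multiset.card_cons] at hn h
        refine hcons (D.α p) (d ::ₘ x) (D.irreducible_α p) ?_ (by rw [Multiset.card_cons]; omega)
          (by omega) (hprod.symm.trans (Multiset.prod_cons _ _).symm)
        exact fun t ht => (Multiset.mem_cons.1 ht).elim (fun e => e ▸ hdi)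
          fun h => hy t (Multiset.mem_cons_of_mem h)

/-- If `a` has a factorization of length `k` and a longer one, then there is `c` with `2 ∈ L(c)`
and `|L(c)| > 1` such that `k + m - 2` is a length of `a` for every length `m` of `c`. -/
lemma exists_lengthSet_of_lt (D : PrimarySystem H P) {a : H} {k l : ℕ} (hk : k ∈ lengthSet a)
    (hl : l ∈ lengthSet a)
    (hkl : k < l) :
    ∃ c : H, 2 ∈ lengthSet c ∧ (lengthSet c).Nontrivial ∧
      ∀ m ∈ lengthSet c, k + m ∈ (fun n => n + 2) '' lengthSet a := by
  obtain ⟨z, hz, rfl, rfl⟩ := D.mem_lengthSet.1 hk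
  obtain ⟨u, w, x, h1, h2, h3, h4⟩ :=
    D.exists_pair_of_card_lt hz (hkl.trans_le (D.le_size_of_mem_lengthSet hl))
  have h22 : 2 ∈ lengthSet (u * w) :=
    D.add_mem_lengthSet (D.mem_lengthSet_of_irreducible (h1 u (by simp)))
      (D.mem_lengthSet_of_irreducible (h1 w (by simp)))
  refine ⟨u * w, h22, ⟨2, h22, _, D.size_mem_lengthSet _, h4.ne⟩, fun m hm => ?_⟩
  have hx : Multiset.card x ∈ lengthSet x.prod :=
    D.mem_lengthSet.2 ⟨x, fun t ht => h1 t (by simp [ht]), rfl, rfl⟩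
  refine ⟨m + Multiset.card x, ?_, by simp only; omega⟩
  have := D.add_mem_lengthSet hm hx
  rwa [mul_assoc, ← Multiset.prod_cons, ← Multiset.prod_cons, h2] at this

/-- If `2 ∈ L(a)`, then the next length of `a` differs from `2` by a distance. -/
lemma daleth_le (D : PrimarySystem H P) : daleth H ≤ 2 + supDelta H := by
  refine iSup₂_le fun a ha => ?_
  have hne : (lengthSet a \ {2}).Nonempty := by
    obtain ⟨x, hx, y, hy, hxy⟩ := ha.2
    by_cases h : x = 2
    · exact ⟨y, hy, fun h' => hxy (h.trans (Set.mem_singleton_iff.1 h').symm)⟩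
    · exact ⟨x, hx, h⟩
  have hm := Nat.sInf_mem hne
  set m := sInf (lengthSet a \ {2})
  have hm2 := D.two_le_of_two_mem_lengthSet ha.1 hm.1
  have hm3 : m ≠ 2 := hm.2
  have hd : m - 2 ∈ distanceSet H := by
    refine Set.mem_iUnion.2 ⟨a, by omega, 2, ha.1, Set.ext fun k => ⟨?_, ?_⟩⟩
    · rintro ⟨hk, hk1, hk2⟩
      by_cases h : k = 2
      · exact Or.inl h
      · have := Nat.sInf_le (show k ∈ lengthSet a \ {2} from ⟨hk, h⟩)
        exact Or.inr (show k = 2 + (m - 2) by omega)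
    · have h2m : 2 + (m - 2) = m := by omega
      rintro (rfl | h)
      · exact ⟨ha.1, le_rfl, by omega⟩
      · rw [Set.mem_singleton_iff, h2m] at h
        exact ⟨h ▸ hm.1, by omega, by omega⟩
  have h1 : ((m - 2 : ℕ) : ℕ∞) ≤ supDelta H := le_iSup₂_of_le (m - 2) hd le_rfl
  calc ((m : ℕ) : ℕ∞) = 2 + ((m - 2 : ℕ) : ℕ∞) := by
        rw [← Nat.cast_ofNat, ← Nat.cast_add]
        congr 1
        omega
    _ ≤ 2 + supDelta H := by gcongr

/-- If `k` and `k + d` are adjacent lengths of `a`, then the element `c` provided by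
`exists_lengthSet_of_lt` has no length strictly between `2` and `2 + d`. -/
lemma add_two_le_daleth {d : ℕ} (D : PrimarySystem H P) (hd : d ∈ distanceSet H) :
    ((2 + d : ℕ) : ℕ∞) ≤ daleth H := by
  obtain ⟨a, hd0, k, hk, hkd⟩ := Set.mem_iUnion.1 hd
  have hkd' : k + d ∈ lengthSet a := by
    have : k + d ∈ lengthSet a ∩ Set.Icc k (k + d) := hkd ▸ Or.inr rfl
    exact this.1
  obtain ⟨c, hc2, hcn, hc⟩ := D.exists_lengthSet_of_lt hk hkd' (by omega)
  refine le_iSup₂_of_le c ⟨hc2, hcn⟩ (Nat.cast_le.2 ?_)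
  have hne : (lengthSet c \ {2}).Nonempty := by
    obtain ⟨x, hx, y, hy, hxy⟩ := hcn
    by_cases h : x = 2
    · exact ⟨y, hy, fun h' => hxy (h.trans (Set.mem_singleton_iff.1 h').symm)⟩
    · exact ⟨x, hx, h⟩
  have hm := Nat.sInf_mem hne
  set m := sInf (lengthSet c \ {2})
  have hm2 := D.two_le_of_two_mem_lengthSet hc2 hm.1
  have hm3 : m ≠ 2 := hm.2
  obtain ⟨n, hn, hnm⟩ := hc m hm.1
  simp only at hnm
  -- a length `m < 2 + d` of `c` would lead to a length of `a` strictly between `k` and `k + d`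
  by_contra! hlt
  have : n ∈ lengthSet a ∩ Set.Icc k (k + d) := ⟨hn, by omega, by omega⟩
  rw [hkd] at this
  rcases this with h | h
  · omega
  · rw [Set.mem_singleton_iff] at h
    omega

/-- Outside the half-factorial case, `daleth` is `2 + sup Δ`. -/
lemma daleth_eq (D : PrimarySystem H P) (h : ¬ IsHalfFactorial H) :
    daleth H = 2 + supDelta H := by
  refine le_antisymm D.daleth_le ?_
  have hne : (distanceSet H).Nonempty := by
    by_contra hempty
    refine h ⟨D.isAtomicMonoid, fun a => ⟨D.size a, Set.ext fun k => ⟨fun hk => ?_, ?_⟩⟩⟩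
    · by_contra hka
      have hlt : k < D.size a := lt_of_le_of_ne (D.le_size_of_mem_lengthSet hk) hka
      -- the distance from `k` to the next larger length
      classical
      have hex : ∃ l, k < l ∧ l ∈ lengthSet a := ⟨_, hlt, D.size_mem_lengthSet a⟩
      obtain ⟨hl1, hl2⟩ := Nat.find_spec hex
      have hadd : k + (Nat.find hex - k) = Nat.find hex := by omega
      refine hempty ⟨Nat.find hex - k, Set.mem_iUnion.2 ⟨a, by omega, k, hk, ?_⟩⟩
      rw [hadd]
      refine Set.ext fun n => ⟨?_, ?_⟩
      · rintro ⟨hn, hn1, hn2⟩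
        by_cases hnk : n = k
        · exact Or.inl hnk
        · have := Nat.find_min' hex ⟨by omega, hn⟩
          exact Or.inr (show n = Nat.find hex by omega)
      · rintro (rfl | hn)
        · exact ⟨hk, le_rfl, hl1.le⟩
        · rw [Set.mem_singleton_iff] at hn
          exact ⟨hn ▸ hl2, by omega, by omega⟩
    · rintro rfl
      exact D.size_mem_lengthSet a
  obtain ⟨d₀, hd₀⟩ := hne
  have : Nonempty (distanceSet H) := ⟨⟨d₀, hd₀⟩⟩
  rw [supDelta, iSup_subtype', ENat.add_iSup]
  refine iSup_le fun d => ?_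
  exact_mod_cast D.add_two_le_daleth d.2

end PrimarySystem

/-! ### Primary components of ideals in one-dimensional domains -/

section Components

variable {R : Type u} [CommRing R]

/-- The component `I R_m ∩ R` of an ideal `I` at a prime ideal `m`. -/
def component (m : Ideal R) [m.IsPrime] (I : Ideal R) : Ideal R where
  carrier := {x | ∃ s ∉ m, s * x ∈ I}
  zero_mem' := ⟨1, m.one_notMem, by simp⟩
  add_mem' := by
    rintro x y ⟨s, hs, hsx⟩ ⟨t, ht, hty⟩
    refine ⟨s * t, fun h => (Ideal.IsPrime.mem_or_mem ‹_› h).elim hs ht, ?_⟩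
    rw [mul_add, mul_right_comm, mul_assoc s t y]
    exact I.add_mem (I.mul_mem_right _ hsx) (I.mul_mem_left _ hty)
  smul_mem' := by
    rintro c x ⟨s, hs, hsx⟩
    exact ⟨s, hs, by rw [smul_eq_mul, mul_left_comm]; exact I.mul_mem_left _ hsx⟩

variable {m n I J : Ideal R}

lemma mem_component [m.IsPrime] {x : R} : x ∈ component m I ↔ ∃ s ∉ m, s * x ∈ I := Iff.rfl

lemma le_component [m.IsPrime] : I ≤ component m I :=
  fun x hx => ⟨1, m.one_notMem, by rwa [one_mul]⟩

lemma component_mono [m.IsPrime] (h : I ≤ J) : component m I ≤ component m J :=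
  fun _ ⟨s, hs, hx⟩ => ⟨s, hs, h hx⟩

lemma component_component [m.IsPrime] : component m (component m I) = component m I := by
  refine le_antisymm ?_ le_component
  rintro x ⟨s, hs, t, ht, h⟩
  exact ⟨t * s, fun h => (Ideal.IsPrime.mem_or_mem ‹_› h).elim ht hs, by rwa [mul_assoc]⟩

lemma component_mul_component_le [m.IsPrime] :
    component m I * component m J ≤ component m (I * J) := by
  rw [Ideal.mul_le]
  rintro x ⟨s, hs, hx⟩ y ⟨t, ht, hy⟩
  refine ⟨s * t, fun h => (Ideal.IsPrime.mem_or_mem ‹_› h).elim hs ht, ?_⟩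
  rw [mul_mul_mul_comm]
  exact Ideal.mul_mem_mul hx hy

lemma component_eq_top_iff [m.IsPrime] : component m I = ⊤ ↔ ¬ I ≤ m := by
  rw [Ideal.eq_top_iff_one, mem_component, SetLike.not_le_iff_exists]
  simp only [mul_one]
  exact ⟨fun ⟨s, h1, h2⟩ => ⟨s, h2, h1⟩, fun ⟨s, h1, h2⟩ => ⟨s, h2, h1⟩⟩

lemma le_of_forall_le_component (h : ∀ m : Ideal R, [m.IsMaximal] → I ≤ component m J) :
    I ≤ J := by
  intro x hx
  let C : Ideal R := Submodule.comap (LinearMap.mulRight R x) J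
  by_contra hxJ
  have hC : C ≠ ⊤ := by
    rw [Ideal.ne_top_iff_one]
    intro h
    exact hxJ (by simpa [C] using h)
  obtain ⟨m, hm, hCm⟩ := Ideal.exists_le_maximal C hC
  obtain ⟨s, hs, hsx⟩ := h m hx
  exact hs (hCm (by simpa [C] using hsx))

lemma eq_of_forall_component_eq
    (h : ∀ m : Ideal R, [m.IsMaximal] → component m I = component m J) : I = J :=
  le_antisymm (le_of_forall_le_component fun m _ => le_component.trans (h m).le)
    (le_of_forall_le_component fun m _ => le_component.trans (h m).ge)

lemma component_pow_self [hm : m.IsMaximal] (k : ℕ) : component m (m ^ k) = m ^ k := by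
  refine le_antisymm ?_ le_component
  rintro x ⟨s, hs, hx⟩
  have h1 : m ⊔ Ideal.span {s} = ⊤ := by
    by_contra hne
    have h2 := hm.eq_of_le hne le_sup_left
    exact hs (h2 ▸ Ideal.mem_sup_right (Ideal.mem_span_singleton_self s))
  have h2 : m ^ k ⊔ Ideal.span {s} = ⊤ := by
    rw [← Ideal.isCoprime_iff_sup_eq] at h1 ⊢
    exact h1.pow_left
  obtain ⟨a, ha, b, hb, hab⟩ := Submodule.mem_sup.1 ((Ideal.eq_top_iff_one _).1 h2)
  obtain ⟨c, rfl⟩ := Ideal.mem_span_singleton'.1 hb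
  have : x = a * x + c * (s * x) := by
    rw [← mul_assoc, ← add_mul, hab, one_mul]
  rw [this]
  exact (m ^ k).add_mem ((m ^ k).mul_mem_right _ ha) ((m ^ k).mul_mem_left _ hx)

lemma component_le_pow_iff [m.IsMaximal] {k : ℕ} : component m I ≤ m ^ k ↔ I ≤ m ^ k :=
  ⟨le_component.trans, fun h => (component_mono h).trans (component_pow_self k).le⟩

lemma component_ne_bot [m.IsPrime] (hI : I ≠ ⊥) : component m I ≠ ⊥ :=
  fun h => hI (le_bot_iff.1 (h ▸ le_component))

/-- The order of an ideal `I` at `m`: the largest `k` such that `I ⊆ m ^ k`. -/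
noncomputable def idealOrder (m : Ideal R) (I : Ideal R) : ℕ :=
  sSup {k | I ≤ m ^ k}

lemma idealOrder_component [m.IsMaximal] : idealOrder m (component m I) =
    idealOrder m I := by
  simp only [idealOrder, component_le_pow_iff]

lemma exists_eq_span_singleton_mul {a : R} (h : I ≤ Ideal.span {a}) :
    ∃ B, I = Ideal.span {a} * B := by
  refine ⟨Submodule.comap (LinearMap.mulLeft R a) I, le_antisymm (fun x hx => ?_) ?_⟩
  · obtain ⟨c, rfl⟩ := Ideal.mem_span_singleton'.1 (h hx)
    rw [Ideal.mem_span_singleton_mul]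
    exact ⟨c, by simpa [mul_comm] using hx, mul_comm _ _⟩
  · rw [Ideal.span_singleton_mul_le_iff]
    exact fun z hz => by simpa using hz

section OneDimensional

variable [IsDomain R] [Ring.KrullDimLE 1 R]

/-- In a one-dimensional domain, the elements of a maximal ideal `m` are nilpotent modulo every
non-zero ideal, locally at `m`. -/
lemma exists_mul_pow_mem [m.IsMaximal] (hI : I ≠ ⊥) {x : R} (hx : x ∈ m) :
    ∃ s ∉ m, ∃ k : ℕ, s * x ^ k ∈ I := by
  by_contra! hc
  have hd : Disjoint (I : Set R) (m.primeCompl ⊔ Submonoid.powers x : Submonoid R) := by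
    rw [Set.disjoint_left]
    intro y hy hy'
    obtain ⟨s, hs, t, ⟨k, rfl⟩, rfl⟩ := Submonoid.mem_sup.1 hy'
    exact hc s hs k hy
  obtain ⟨Q, hQ, hIQ, hQd⟩ := Ideal.exists_le_prime_disjoint I _ hd
  have hQm : Q.IsMaximal :=
    Ideal.isMaximal_of_isPrime_of_ne_bot Q fun h => hI (le_bot_iff.1 (h ▸ hIQ))
  have hle : Q ≤ m := fun y hy => by
    by_contra hym
    exact Set.disjoint_left.1 hQd hy (SetLike.le_def.1 le_sup_left hym)
  have hQe := hQm.eq_of_le (Ideal.IsPrime.ne_top inferInstance) hle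
  refine Set.disjoint_left.1 hQd (hQe ▸ hx) ?_
  exact SetLike.le_def.1 le_sup_right (Submonoid.mem_powers x)

/-- Components at different maximal ideals are coprime. -/
lemma component_component_of_ne [m.IsMaximal] [n.IsMaximal] (h : m ≠ n) (hI : I ≠ ⊥) :
    component m (component n I) = ⊤ := by
  rw [component_eq_top_iff, SetLike.not_le_iff_exists]
  obtain ⟨x, hxn, hxm⟩ := SetLike.not_le_iff_exists.1 fun hle : n ≤ m =>
    h ((Ideal.IsMaximal.eq_of_le inferInstance (Ideal.IsPrime.ne_top inferInstance) hle).symm)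
  obtain ⟨s, hs, k, hk⟩ := exists_mul_pow_mem hI hxn
  exact ⟨x ^ k, ⟨s, hs, hk⟩, fun hx => hxm (Ideal.IsPrime.mem_of_pow_mem inferInstance k hx)⟩

/-- Localization commutes with products; at the other maximal ideals both sides are trivial. -/
lemma component_mul [m.IsMaximal] : component m (I * J) = component m I * component m J := by
  refine le_antisymm ?_ component_mul_component_le
  by_cases hI : I = ⊥
  · subst hI
    rintro x ⟨s, hs, hx⟩
    rw [Ideal.bot_mul, Ideal.mem_bot, mul_eq_zero] at hx
    rcases hx with h | h
    · exact absurd (h ▸ m.zero_mem) hs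
    · exact h ▸ zero_mem _
  by_cases hJ : J = ⊥
  · subst hJ
    rintro x ⟨s, hs, hx⟩
    rw [Ideal.mul_bot, Ideal.mem_bot, mul_eq_zero] at hx
    rcases hx with h | h
    · exact absurd (h ▸ m.zero_mem) hs
    · exact h ▸ zero_mem _
  refine le_of_forall_le_component fun n _ => ?_
  by_cases hn : n = m
  · subst hn
    exact component_mono (Ideal.mul_mono le_component le_component)
  · refine le_trans ?_ component_mul_component_le
    rw [component_component_of_ne hn hI, component_component_of_ne hn hJ, Ideal.top_mul]
    exact le_top

/-- Passing to the component at `m`, as a homomorphism. -/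
def componentHom (m : Ideal R) [m.IsMaximal] : Ideal R →* Ideal R where
  toFun := component m
  map_one' := by
    rw [Ideal.one_eq_top]
    exact top_le_iff.1 le_component
  map_mul' _ _ := component_mul

/-- A non-zero ideal contained in only finitely many maximal ideals is the product of its
components. -/
lemma eq_prod_component (hI : I ≠ ⊥) (hfin : {m : MaximalSpectrum R | I ≤ m.asIdeal}.Finite) :
    I = ∏ n ∈ hfin.toFinset, component n.asIdeal I := by
  classical
  refine eq_of_forall_component_eq fun m hm => ?_
  change _ = componentHom m _
  rw [map_prod]
  change _ = ∏ n ∈ hfin.toFinset, component m (component n.asIdeal I)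
  have hne : ∀ n : MaximalSpectrum R, n ≠ ⟨m, hm⟩ → component m (component n.asIdeal I) = 1 :=
    fun n hn => (component_component_of_ne (fun h => hn (MaximalSpectrum.ext h.symm)) hI).trans
      Ideal.one_eq_top.symm
  by_cases h : I ≤ m
  · rw [Finset.prod_eq_single ⟨m, hm⟩, component_component]
    · exact fun n _ hn => hne n hn
    · exact fun h' => absurd (hfin.mem_toFinset.2 h) h'
  · rw [component_eq_top_iff.2 h, ← Ideal.one_eq_top, Finset.prod_eq_one]
    exact fun n hn => hne n fun e => h (by simpa [e] using hn)

lemma exists_eq_component_mul (hI : I ≠ ⊥)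
    (hfin : {m : MaximalSpectrum R | I ≤ m.asIdeal}.Finite) (m : Ideal R) [hm : m.IsMaximal] :
    ∃ C, I = component m I * C := by
  classical
  by_cases h : I ≤ m
  · refine ⟨∏ n ∈ hfin.toFinset.erase ⟨m, hm⟩, component n.asIdeal I, ?_⟩
    have := Finset.mul_prod_erase hfin.toFinset (fun n => component n.asIdeal I)
      (a := ⟨m, hm⟩) (hfin.mem_toFinset.2 h)
    exact (eq_prod_component hI hfin).trans this.symm
  · exact ⟨I, by rw [component_eq_top_iff.2 h, Ideal.top_mul]⟩

end OneDimensional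

end Components

/-! ### Local parameters -/

/-- Elements `α m ∈ m`, one for each maximal ideal `m`, such that locally at `m` the square of
`m` is `α m • m`; in addition, every non-zero element lies in only finitely many maximal ideals. -/
structure LocalParameters (R : Type u) [CommRing R] where
  α : MaximalSpectrum R → R
  mem : ∀ m, α m ∈ m.asIdeal
  ne_zero : ∀ m, α m ≠ 0
  sq_le : ∀ m, m.asIdeal ^ 2 ≤ component m.asIdeal (Ideal.span {α m} * m.asIdeal)
  finite : ∀ x : R, x ≠ 0 → {m : MaximalSpectrum R | x ∈ m.asIdeal}.Finite

namespace LocalParameters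

variable {R : Type u} [CommRing R] (A : LocalParameters R) (m : MaximalSpectrum R) {I J : Ideal R}

lemma pow_succ_le (k : ℕ) :
    m.asIdeal ^ (k + 1) ≤ component m.asIdeal (Ideal.span {A.α m} ^ k * m.asIdeal) := by
  induction k with
  | zero => simpa using le_component
  | succ k ih =>
    rw [pow_succ]
    refine (Ideal.mul_mono ih le_component).trans (component_mul_component_le.trans ?_)
    rw [mul_assoc, ← pow_two, pow_succ _ k, mul_assoc, ← component_component (m := m.asIdeal)
      (I := Ideal.span {A.α m} ^ k * (Ideal.span {A.α m} * m.asIdeal))]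
    refine component_mono ((Ideal.mul_mono_right (A.sq_le m)).trans ?_)
    exact (Ideal.mul_mono_left le_component).trans component_mul_component_le

lemma finite_of_ne_bot (A : LocalParameters R) (hI : I ≠ ⊥) :
    {m : MaximalSpectrum R | I ≤ m.asIdeal}.Finite := by
  obtain ⟨x, hx, hx0⟩ := Submodule.exists_mem_ne_zero_of_ne_bot hI
  exact (A.finite x hx0).subset fun m hm => hm hx

lemma span_α_ne_bot : Ideal.span {A.α m} ≠ ⊥ := by
  simpa using A.ne_zero m

/-- The ideal `α R_m ∩ R`. It is the local substitute for `α R` that lives at `m` only. -/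
def αIdeal : Ideal R := component m.asIdeal (Ideal.span {A.α m})

lemma αIdeal_ne_bot : A.αIdeal m ≠ ⊥ := component_ne_bot (A.span_α_ne_bot m)

lemma exists_of_mem_pow {k : ℕ} {x : R} (hx : x ∈ m.asIdeal ^ (k + 1)) :
    ∃ s ∉ m.asIdeal, ∃ z ∈ m.asIdeal, s * x = A.α m ^ k * z := by
  obtain ⟨s, hs, h⟩ := A.pow_succ_le m k hx
  rw [Ideal.span_singleton_pow, Ideal.mem_span_singleton_mul] at h
  obtain ⟨z, hz, h⟩ := h
  exact ⟨s, hs, z, hz, h.symm⟩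

lemma α_pow_mul_mem {k : ℕ} {z : R} (hz : z ∈ m.asIdeal) : A.α m ^ k * z ∈ m.asIdeal ^ (k + 1) := by
  rw [pow_succ]
  exact Ideal.mul_mem_mul (Ideal.pow_mem_pow (A.mem m) k) hz

variable [IsDomain R]

/-- Multiplication by `α m` raises the `m`-adic order by exactly one. -/
lemma α_mul_mem_pow_succ_iff {k : ℕ} {x : R} :
    A.α m * x ∈ m.asIdeal ^ (k + 1) ↔ x ∈ m.asIdeal ^ k := by
  refine ⟨fun h => ?_, fun h => by rw [pow_succ']; exact Ideal.mul_mem_mul (A.mem m) h⟩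
  cases k with
  | zero => simp
  | succ k =>
    obtain ⟨s, hs, z, hz, h⟩ := A.exists_of_mem_pow m h
    rw [← component_pow_self]
    refine ⟨s, hs, ?_⟩
    have : s * x = A.α m ^ k * z := mul_left_cancel₀ (A.ne_zero m) (by rw [mul_left_comm, h]; ring)
    rw [this]
    exact A.α_pow_mul_mem m hz

variable [Ring.KrullDimLE 1 R]

/-- The powers of `m` have trivial intersection, locally: some `α ^ n` is locally in `I`, and the
order of `α ^ n` is `n` locally. -/
lemma exists_not_le_pow (A : LocalParameters R) (hI : I ≠ ⊥) :
    ∃ N, ∀ k, I ≤ m.asIdeal ^ k → k ≤ N := by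
  obtain ⟨s, hs, n, hn⟩ := exists_mul_pow_mem hI (A.mem m)
  refine ⟨n + 1, fun k hk => ?_⟩
  by_contra! hlt
  have hle : 1 + n + 1 ≤ k := by omega
  have h1 : s * A.α m ^ n ∈ m.asIdeal ^ (1 + n + 1) := Ideal.pow_le_pow_right hle (hk hn)
  have h2 : ∀ j, s * A.α m ^ j ∈ m.asIdeal ^ (1 + j + 1) → s ∈ m.asIdeal := by
    intro j
    induction j with
    | zero =>
      intro h
      rw [pow_zero, mul_one] at h
      exact Ideal.pow_le_self (by omega) h
    | succ j ih =>
      intro h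
      refine ih ((A.α_mul_mem_pow_succ_iff m).1 ?_)
      rwa [mul_left_comm, ← pow_succ']
  exact hs (h2 n h1)

lemma le_idealOrder_iff (A : LocalParameters R) (hI : I ≠ ⊥) {k : ℕ} :
    k ≤ idealOrder m.asIdeal I ↔ I ≤ m.asIdeal ^ k := by
  obtain ⟨N, hN⟩ := A.exists_not_le_pow m hI
  have hbdd : BddAbove {k | I ≤ m.asIdeal ^ k} := ⟨N, hN⟩
  refine ⟨fun h => ?_, fun h => le_csSup hbdd h⟩
  have hmem : idealOrder m.asIdeal I ∈ {k | I ≤ m.asIdeal ^ k} := Nat.sSup_mem ⟨0, by simp⟩ hbdd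
  exact le_trans hmem (Ideal.pow_le_pow_right h)

lemma idealOrder_eq_zero_iff (A : LocalParameters R) (hI : I ≠ ⊥) :
    idealOrder m.asIdeal I = 0 ↔ component m.asIdeal I = ⊤ := by
  rw [component_eq_top_iff, ← pow_one m.asIdeal, ← A.le_idealOrder_iff m hI, pow_one]
  omega

lemma add_le_idealOrder_mul (A : LocalParameters R) (hI : I ≠ ⊥) (hJ : J ≠ ⊥) :
    idealOrder m.asIdeal I + idealOrder m.asIdeal J ≤ idealOrder m.asIdeal (I * J) := by
  rw [A.le_idealOrder_iff m (mul_ne_zero hI hJ), pow_add]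
  exact Ideal.mul_mono ((A.le_idealOrder_iff m hI).1 le_rfl) ((A.le_idealOrder_iff m hJ).1 le_rfl)

lemma component_αIdeal_mul :
    component m.asIdeal (A.αIdeal m * I) = component m.asIdeal (Ideal.span {A.α m} * I) := by
  rw [component_mul, component_mul, αIdeal, component_component]

lemma component_αIdeal_mul_of_ne {n : MaximalSpectrum R} (h : n ≠ m) :
    component n.asIdeal (A.αIdeal m * I) = component n.asIdeal I := by
  rw [component_mul, αIdeal, component_component_of_ne (fun e => h (MaximalSpectrum.ext e))
    (A.span_α_ne_bot m), Ideal.top_mul]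

lemma αIdeal_mul_cancel (h : A.αIdeal m * I = A.αIdeal m * J) : I = J := by
  refine eq_of_forall_component_eq fun n hn => ?_
  by_cases hnm : (⟨n, hn⟩ : MaximalSpectrum R) = m
  · have hc : component m.asIdeal (Ideal.span {A.α m} * I) =
        component m.asIdeal (Ideal.span {A.α m} * J) := by
      rw [← A.component_αIdeal_mul, h, A.component_αIdeal_mul]
    have key : ∀ K L : Ideal R, component m.asIdeal (Ideal.span {A.α m} * K) ≤
        component m.asIdeal (Ideal.span {A.α m} * L) →
        component m.asIdeal K ≤ component m.asIdeal L := by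
      rintro K L hKL x ⟨s, hs, hx⟩
      obtain ⟨t, ht, htx⟩ := hKL (le_component (m := m.asIdeal)
        (Ideal.mul_mem_mul (Ideal.mem_span_singleton_self (A.α m)) hx))
      rw [Ideal.mem_span_singleton_mul] at htx
      obtain ⟨z, hz, hzx⟩ := htx
      refine ⟨t * s, fun h => (Ideal.IsPrime.mem_or_mem inferInstance h).elim ht hs, ?_⟩
      have : t * s * x = z := mul_left_cancel₀ (A.ne_zero m) (by rw [hzx]; ring)
      rwa [this]
    subst hnm
    exact le_antisymm (key _ _ hc.le) (key _ _ hc.ge)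
  · have := congrArg (component (⟨n, hn⟩ : MaximalSpectrum R).asIdeal) h
    rwa [A.component_αIdeal_mul_of_ne m hnm, A.component_αIdeal_mul_of_ne m hnm] at this

lemma idealOrder_αIdeal_mul (hI : I ≠ ⊥) :
    idealOrder m.asIdeal (A.αIdeal m * I) = idealOrder m.asIdeal I + 1 := by
  have hAI : A.αIdeal m * I ≠ ⊥ := mul_ne_zero (A.αIdeal_ne_bot m) hI
  have key : ∀ k, A.αIdeal m * I ≤ m.asIdeal ^ (k + 1) ↔ I ≤ m.asIdeal ^ k := by
    intro k
    rw [← component_le_pow_iff, component_αIdeal_mul, component_le_pow_iff,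
      Ideal.span_singleton_mul_le_iff]
    exact forall₂_congr fun x _ => A.α_mul_mem_pow_succ_iff m
  refine le_antisymm ?_ ?_
  · cases hk : idealOrder m.asIdeal (A.αIdeal m * I) with
    | zero => exact Nat.zero_le _
    | succ k =>
      have h1 := (A.le_idealOrder_iff m hAI).1 hk.ge
      exact Nat.succ_le_succ ((A.le_idealOrder_iff m hI).2 ((key k).1 h1))
  · rw [A.le_idealOrder_iff m hAI, key, ← A.le_idealOrder_iff m hI]

lemma exists_αIdeal_mul_eq_span : ∃ C, A.αIdeal m * C = Ideal.span {A.α m} := by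
  obtain ⟨C, hC⟩ := exists_eq_component_mul (A.span_α_ne_bot m)
    (A.finite_of_ne_bot (A.span_α_ne_bot m)) m.asIdeal
  exact ⟨C, hC.symm⟩

/-- If `I ⊆ m ^ 2`, then `I` is contained in the ideal `α R_m ∩ R`, which divides the principal
ideal `α R`; multiplication by the cofactor `C` therefore reduces divisibility to containment. -/
lemma αIdeal_dvd (hI : I ≠ ⊥) (h : 2 ≤ idealOrder m.asIdeal I) : ∃ B, I = A.αIdeal m * B := by
  obtain ⟨C, hC⟩ := A.exists_αIdeal_mul_eq_span m
  have hle : I ≤ A.αIdeal m := ((A.le_idealOrder_iff m hI).1 h).trans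
    ((A.sq_le m).trans (component_mono Ideal.mul_le_left))
  obtain ⟨B, hB⟩ := exists_eq_span_singleton_mul (I := I * C) (a := A.α m)
    (hC ▸ Ideal.mul_mono_left hle)
  refine ⟨B, (Ideal.span_singleton_mul_right_inj (A.ne_zero m)).1 ?_⟩
  rw [mul_left_comm, ← hB, ← hC]
  ring

/-- The primary decomposition of a divisor-closed monoid of non-zero ideals. -/
noncomputable def primarySystem (T : Submonoid (Ideal R)) (hT : ∀ I ∈ T, I ≠ ⊥)
    (hdvd : ∀ I J, I * J ∈ T → I ∈ T ∧ J ∈ T) (hspan : ∀ a : R, a ≠ 0 → Ideal.span {a} ∈ T) :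
    PrimarySystem T (MaximalSpectrum R) where
  π m := ((componentHom m.asIdeal).comp T.subtype).codRestrict T fun I => by
    obtain ⟨C, hC⟩ := exists_eq_component_mul (hT I I.2) (A.finite_of_ne_bot (hT I I.2)) m.asIdeal
    exact (hdvd _ C (hC ▸ I.2)).1
  v m I := idealOrder m.asIdeal I
  α m := ⟨A.αIdeal m, by
    obtain ⟨C, hC⟩ := A.exists_αIdeal_mul_eq_span m
    exact (hdvd _ C (hC ▸ hspan _ (A.ne_zero m))).1⟩
  finite_supp I := by
    refine (A.finite_of_ne_bot (hT I I.2)).subset fun m hm => ?_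
    by_contra hI
    exact hm (Subtype.ext ((component_eq_top_iff.2 hI).trans Ideal.one_eq_top.symm))
  ext I J h := Subtype.ext (eq_of_forall_component_eq fun m hm =>
    congrArg Subtype.val (h ⟨m, hm⟩))
  π_self m I := Subtype.ext component_component
  π_ne m n I h := Subtype.ext ((component_component_of_ne
    (fun e => h (MaximalSpectrum.ext e)) (hT I I.2)).trans Ideal.one_eq_top.symm)
  v_eq_zero m I := (A.idealOrder_eq_zero_iff m (hT I I.2)).trans
    ⟨fun h => Subtype.ext (h.trans Ideal.one_eq_top.symm),
      fun h => (congrArg Subtype.val h).trans Ideal.one_eq_top⟩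
  v_π m I := idealOrder_component
  le_v_mul m I J := A.add_le_idealOrder_mul m (hT I I.2) (hT J J.2)
  v_α_mul m I := A.idealOrder_αIdeal_mul m (hT I I.2)
  π_α m := Subtype.ext component_component
  α_cancel m I J h := Subtype.ext (A.αIdeal_mul_cancel m (congrArg Subtype.val h))
  α_dvd m I h := by
    obtain ⟨B, hB⟩ := A.αIdeal_dvd m (hT I I.2) h
    exact ⟨⟨B, (hdvd _ B (hB ▸ I.2)).2⟩, Subtype.ext hB⟩

/-- If the orders are additive on principal ideals, then they are additive on all ideals, since
the order of `I` is the least order of an element of `I`. -/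
lemma idealOrder_mul_of_span (A : LocalParameters R)
    (h : ∀ x y : R, x ≠ 0 → y ≠ 0 → idealOrder m.asIdeal (Ideal.span {x} * Ideal.span {y}) =
      idealOrder m.asIdeal (Ideal.span {x}) + idealOrder m.asIdeal (Ideal.span {y}))
    (hI : I ≠ ⊥) (hJ : J ≠ ⊥) :
    idealOrder m.asIdeal (I * J) = idealOrder m.asIdeal I + idealOrder m.asIdeal J := by
  refine le_antisymm ?_ (A.add_le_idealOrder_mul m hI hJ)
  have key : ∀ K : Ideal R, K ≠ ⊥ → ∃ x ∈ K, x ≠ 0 ∧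
      idealOrder m.asIdeal (Ideal.span {x}) ≤ idealOrder m.asIdeal K := by
    intro K hK
    have hlt : ¬ K ≤ m.asIdeal ^ (idealOrder m.asIdeal K + 1) := by
      rw [← A.le_idealOrder_iff m hK]
      omega
    obtain ⟨x, hx, hxn⟩ := SetLike.not_le_iff_exists.1 hlt
    have hx0 : x ≠ 0 := fun h0 => hxn (h0 ▸ zero_mem _)
    refine ⟨x, hx, hx0, ?_⟩
    by_contra! hlt
    refine hxn ((A.le_idealOrder_iff m (by simpa using hx0)).1 hlt
      (Ideal.mem_span_singleton_self x))
  obtain ⟨x, hx, hx0, hxI⟩ := key I hI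
  obtain ⟨y, hy, hy0, hyJ⟩ := key J hJ
  have hle : Ideal.span {x} * Ideal.span {y} ≤ I * J := Ideal.mul_mono
    ((Ideal.span_singleton_le_iff_mem _).2 hx) ((Ideal.span_singleton_le_iff_mem _).2 hy)
  have h1 : idealOrder m.asIdeal (I * J) ≤
      idealOrder m.asIdeal (Ideal.span {x} * Ideal.span {y}) := by
    rw [A.le_idealOrder_iff m (mul_ne_zero (by simpa using hx0) (by simpa using hy0))]
    exact hle.trans ((A.le_idealOrder_iff m (mul_ne_zero hI hJ)).1 le_rfl)
  rw [h x y hx0 hy0] at h1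
  omega

end LocalParameters

/-! ### Mori domains and finiteness of colons -/

section FiniteColons

variable {K : Type v} [Field K]

/-- Every bounded subset `X` of `K` has a finite subset `Y` with `(N : X) = (N : Y)`. For the
subring `N = R` of the quotient field `K` of `R` this says that `R` is a Mori domain, but in this
form the property passes to localizations and to colons. -/
def HasFiniteColons (N : Set K) : Prop :=
  ∀ X : Set K, (∃ c ≠ 0, ∀ x ∈ X, c * x ∈ N) →
    ∃ Y : Finset K, ↑Y ⊆ X ∧ ∀ z, (∀ y ∈ Y, z * y ∈ N) → ∀ x ∈ X, z * x ∈ N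

lemma HasFiniteColons.colon {N : Set K} (hN : HasFiniteColons N) (W : Set K) :
    HasFiniteColons {z | ∀ w ∈ W, z * w ∈ N} := by
  classical
  rintro X ⟨c, hc, hX⟩
  obtain ⟨Y, hY, hYX⟩ := hN ((fun p : K × K => p.1 * p.2) '' X ×ˢ W) ⟨c, hc, by
    rintro _ ⟨⟨x, w⟩, ⟨hx, hw⟩, rfl⟩
    simpa only [mul_assoc] using hX x hx w hw⟩
  obtain ⟨F, hF, rfl⟩ := Finset.subset_set_image_iff.1 hY
  refine ⟨F.image Prod.fst, ?_, fun z hz x hx w hw => ?_⟩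
  · intro x hx
    obtain ⟨p, hp, rfl⟩ := Finset.mem_image.1 (Finset.mem_coe.1 hx)
    exact (hF hp).1
  · rw [mul_assoc]
    refine hYX z (fun y hy => ?_) _ ⟨(x, w), ⟨hx, hw⟩, rfl⟩
    obtain ⟨p, hp, rfl⟩ := Finset.mem_image.1 hy
    rw [← mul_assoc]
    exact hz _ (Finset.mem_image_of_mem _ hp) _ (hF hp).2

variable {R : Type u} [CommRing R] [Algebra R K]

/-- The localization `N_m` of a submodule `N` of `K` at a prime ideal `m`. -/
def localizedAt (m : Ideal R) [m.IsPrime] (N : Submodule R K) : Submodule R K where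
  carrier := {x | ∃ s ∉ m, s • x ∈ N}
  zero_mem' := ⟨1, m.one_notMem, by simp⟩
  add_mem' := by
    rintro x y ⟨s, hs, hsx⟩ ⟨t, ht, hty⟩
    refine ⟨s * t, fun h => (Ideal.IsPrime.mem_or_mem ‹_› h).elim hs ht, ?_⟩
    rw [smul_add, mul_comm s t, mul_smul, mul_comm t s, mul_smul]
    exact N.add_mem (N.smul_mem _ hsx) (N.smul_mem _ hty)
  smul_mem' := by
    rintro c x ⟨s, hs, hsx⟩
    exact ⟨s, hs, by rw [smul_comm]; exact N.smul_mem _ hsx⟩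

lemma le_localizedAt {m : Ideal R} [m.IsPrime] {N : Submodule R K} : N ≤ localizedAt m N :=
  fun x hx => ⟨1, m.one_notMem, by rwa [one_smul]⟩

lemma HasFiniteColons.localizedAt {N : Submodule R K} (hN : HasFiniteColons (N : Set K))
    (m : Ideal R) [m.IsPrime] : HasFiniteColons (localizedAt m N : Set K) := by
  classical
  rintro X ⟨c, hc, hX⟩
  have hX' : ∀ x : K, ∃ s ∉ m, x ∈ X → s • (c * x) ∈ N := fun x => by
    by_cases hx : x ∈ X
    · obtain ⟨s, hs, h⟩ := hX x hx
      exact ⟨s, hs, fun _ => h⟩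
    · exact ⟨1, m.one_notMem, fun h => absurd h hx⟩
  choose s hs hsX using hX'
  obtain ⟨Y, hY, hYX⟩ := hN ((fun x => s x • x) '' X) ⟨c, hc, by
    rintro _ ⟨x, hx, rfl⟩
    simpa only [mul_smul_comm, SetLike.mem_coe] using hsX x hx⟩
  obtain ⟨F, hF, rfl⟩ := Finset.subset_set_image_iff.1 hY
  refine ⟨F, hF, fun z hz x hx => ?_⟩
  have hz' : ∀ y : K, ∃ t ∉ m, y ∈ F → t • (z * y) ∈ N := fun y => by
    by_cases hy : y ∈ F
    · obtain ⟨t, ht, h⟩ := hz y hy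
      exact ⟨t, ht, fun _ => h⟩
    · exact ⟨1, m.one_notMem, fun h => absurd h hy⟩
  choose t ht htz using hz'
  have hT : ∏ y ∈ F, t y ∉ m := fun h => by
    obtain ⟨y, -, hy⟩ := (Ideal.IsPrime.prod_mem_iff (hp := ‹_›)).1 h
    exact ht y hy
  refine ⟨(∏ y ∈ F, t y) * s x, fun h => (Ideal.IsPrime.mem_or_mem ‹_› h).elim hT (hs x), ?_⟩
  have := hYX ((∏ y ∈ F, t y) • z) (fun y' hy' => ?_) _ ⟨x, hx, rfl⟩
  · rwa [smul_mul_smul_comm] at this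
  · obtain ⟨y, hy, rfl⟩ := Finset.mem_image.1 hy'
    rw [← Finset.prod_erase_mul _ _ hy, mul_smul, smul_mul_assoc, mul_smul_comm, smul_mul_assoc]
    exact N.smul_mem _ (N.smul_mem _ (htz y hy))

end FiniteColons

section Divisorial

variable {D : Type u} [CommRing D] {K : Type v} [Field K] [Algebra D K]

lemma mem_one_div_iff {N : Submodule D K} {z : K} :
    z ∈ (1 : Submodule D K) / N ↔ ∀ y ∈ N, z * y ∈ Set.range (algebraMap D K) := by
  rw [Submodule.mem_div_iff_forall_mul_mem]
  exact forall₂_congr fun y _ => Submodule.mem_one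

/-- The ideal of all elements of `D` which are multiplied into `D` by the elements of `Z`. -/
def colonIdeal (Z : Set K) : Ideal D where
  carrier := {r | ∀ z ∈ Z, z * algebraMap D K r ∈ (algebraMap D K).range}
  zero_mem' z _ := by simp
  add_mem' ha hb z hz := by
    rw [map_add, mul_add]
    exact add_mem (ha z hz) (hb z hz)
  smul_mem' c r hr z hz := by
    rw [smul_eq_mul, map_mul, mul_left_comm]
    exact mul_mem ⟨c, rfl⟩ (hr z hz)

lemma isDivisorialIdeal_colonIdeal {Z : Set K} (hZ : (1 : K) ∈ Z) :
    IsDivisorialIdeal K (colonIdeal Z : Ideal D) := by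
  refine le_antisymm (fun x hx => ?_) (fun x hx => ?_)
  · rw [mem_one_div_iff] at hx
    have hx' : ∀ z ∈ Z, x * z ∈ Set.range (algebraMap D K) := fun z hz => by
      refine hx z (mem_one_div_iff.2 ?_)
      rintro _ ⟨r, hr, rfl⟩
      exact hr z hz
    obtain ⟨r, hr⟩ := hx' 1 hZ
    rw [mul_one] at hr
    refine ⟨r, fun z hz => ?_, hr⟩
    change z * algebraMap D K r ∈ Set.range (algebraMap D K)
    rw [hr, mul_comm]
    exact hx' z hz
  · rw [mem_one_div_iff]
    intro z hz
    rw [mul_comm]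
    exact mem_one_div_iff.1 hz x hx

/-- If `c X ⊆ R`, then the finite subsets `F` of `X` give rise to the divisorial ideals
`(R : (R : c F))`, and a maximal one among these belongs to a set `F` with `(R : F) = (R : X)`. -/
lemma IsMoriDomain.hasFiniteColons (h : IsMoriDomain D K) :
    HasFiniteColons (Set.range (algebraMap D K)) := by
  classical
  rintro X ⟨c, hc, hX⟩
  let Z : Finset K → Set K := fun F => {z | ∀ y ∈ F, z * (c * y) ∈ Set.range (algebraMap D K)}
  have hone : ∀ F : Finset K, ↑F ⊆ X → (1 : K) ∈ Z F := fun F hF y hy => by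
    rw [one_mul]
    exact hX y (hF hy)
  let f : {F : Finset K // ↑F ⊆ X} → {I : Ideal D // IsDivisorialIdeal K I} :=
    fun F => ⟨colonIdeal (Z F), isDivisorialIdeal_colonIdeal (hone F.1 F.2)⟩
  have hwf : WellFounded ((· > ·) : {I : Ideal D // IsDivisorialIdeal K I} → _ → Prop) := h.wf
  obtain ⟨_, ⟨⟨F, hF⟩, rfl⟩, hmax⟩ :=
    hwf.has_min (Set.range f) ⟨_, ⟨∅, by simp⟩, rfl⟩
  refine ⟨F, hF, fun z hz x hx => ?_⟩
  have hFx : ↑(insert x F) ⊆ X := by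
    rw [Finset.coe_insert]
    exact Set.insert_subset hx hF
  have hle : f ⟨F, hF⟩ ≤ f ⟨insert x F, hFx⟩ := by
    intro r hr z hz
    exact hr z fun y hy => hz y (Finset.mem_insert_of_mem hy)
  have hge : f ⟨insert x F, hFx⟩ ≤ f ⟨F, hF⟩ := by
    by_contra hn
    exact hmax _ ⟨_, rfl⟩ (lt_of_le_not_ge hle hn)
  obtain ⟨r, hr⟩ := hX x hx
  have hr' : r ∈ (f ⟨insert x F, hFx⟩).1 := by
    intro w hw
    have := hw x (Finset.mem_insert_self x F)
    rwa [← hr] at this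
  have := hge hr' (z / c) fun y hy => by
    rw [← mul_assoc, div_mul_cancel₀ _ hc]
    exact hz y hy
  rw [hr, ← mul_assoc, div_mul_cancel₀ _ hc] at this
  exact this

variable (K) in
/-- Divisoriality, in terms of elements. -/
def IsDivisorial (I : Ideal D) : Prop :=
  ∀ x : D, (∀ z : K, (∀ y ∈ I, z * algebraMap D K y ∈ Set.range (algebraMap D K)) →
    z * algebraMap D K x ∈ Set.range (algebraMap D K)) → x ∈ I

/-- In a Mori domain, pairwise incomparable divisorial primes with a common non-zero element are
finite in number: the intersections of more and more of them would form a strictly descending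
sequence `I n`, and the colons `(D : I n)` are bounded. -/
lemma finite_of_isDivisorial [IsDomain D] [IsFractionRing D K]
    (hD : HasFiniteColons (Set.range (algebraMap D K))) {t : D} (ht : t ≠ 0) {Ω : Set (Ideal D)}
    (hprime : ∀ P ∈ Ω, P.IsPrime) (hdiv : ∀ P ∈ Ω, IsDivisorial K P) (htΩ : ∀ P ∈ Ω, t ∈ P)
    (hanti : ∀ P ∈ Ω, ∀ Q ∈ Ω, P ≤ Q → P = Q) : Ω.Finite := by
  by_contra hinf
  let f := Set.Infinite.natEmbedding Ω hinf
  let I : ℕ → Ideal D := fun n => (Finset.range (n + 1)).inf fun i => (f i).1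
  have hI : ∀ {n x}, x ∈ I n ↔ ∀ i ≤ n, x ∈ (f i).1 := fun {n x} => by
    simp [I, Submodule.mem_finsetInf]
  let X : Set K := {z | ∃ n, ∀ y ∈ I n, z * algebraMap D K y ∈ Set.range (algebraMap D K)}
  obtain ⟨Y, hY, hYX⟩ := hD X ⟨algebraMap D K t,
    (map_ne_zero_iff _ (IsFractionRing.injective D K)).2 ht, by
      rintro z ⟨n, hn⟩
      rw [mul_comm]
      exact hn t (hI.2 fun i _ => htΩ _ (f i).2)⟩
  obtain ⟨N, hN⟩ : ∃ N, ∀ z ∈ Y, ∀ y ∈ I N,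
      z * algebraMap D K y ∈ Set.range (algebraMap D K) := by
    have : ∀ z : K, ∃ n, z ∈ Y → ∀ y ∈ I n,
        z * algebraMap D K y ∈ Set.range (algebraMap D K) := fun z => by
      by_cases hz : z ∈ Y
      · obtain ⟨n, hn⟩ := hY hz
        exact ⟨n, fun _ => hn⟩
      · exact ⟨0, fun h => absurd h hz⟩
    choose n hn using this
    refine ⟨Y.sup n, fun z hz y hy => hn z hz y (hI.2 fun i hi => hI.1 hy i ?_)⟩
    exact hi.trans (Finset.le_sup hz)
  have hle : I N ≤ (f (N + 1)).1 := fun x hx => hdiv _ (f (N + 1)).2 x fun z hz => by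
    rw [mul_comm]
    refine hYX _ (fun y hy => by rw [mul_comm]; exact hN y hy x hx) z ⟨N + 1, fun y hy => ?_⟩
    exact hz y (hI.1 hy (N + 1) le_rfl)
  have := hprime _ (f (N + 1)).2
  obtain ⟨i, hi, hle⟩ := (Ideal.IsPrime.inf_le' this).1 hle
  have heq := f.injective (Subtype.ext (hanti _ (f i).2 _ (f (N + 1)).2 hle))
  rw [Finset.mem_range] at hi
  omega

/-- In a Mori domain the divisorial ideals satisfy the ascending chain condition. -/
lemma wellFoundedGT_isDivisorial [IsDomain D] [IsFractionRing D K]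
    (hD : HasFiniteColons (Set.range (algebraMap D K))) :
    WellFoundedGT {I : Ideal D // IsDivisorial K I} := by
  rw [wellFoundedGT_iff_monotone_chain_condition]
  intro a
  let X : Set K := {z | ∃ n, ∃ x ∈ (a n).1, algebraMap D K x = z}
  obtain ⟨Y, hY, hYX⟩ := hD X ⟨1, one_ne_zero, by
    rintro z ⟨n, x, -, rfl⟩
    exact ⟨x, (one_mul _).symm⟩⟩
  obtain ⟨N, hN⟩ : ∃ N, ∀ z ∈ Y, ∃ x ∈ (a N).1, algebraMap D K x = z := by
    have : ∀ z : K, ∃ n, z ∈ Y → ∃ x ∈ (a n).1, algebraMap D K x = z := fun z => by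
      by_cases hz : z ∈ Y
      · obtain ⟨n, hn⟩ := hY hz
        exact ⟨n, fun _ => hn⟩
      · exact ⟨0, fun h => absurd h hz⟩
    choose n hn using this
    refine ⟨Y.sup n, fun z hz => ?_⟩
    obtain ⟨x, hx, rfl⟩ := hn z hz
    exact ⟨x, a.monotone (Finset.le_sup hz) hx, rfl⟩
  refine ⟨N, fun k hk => le_antisymm (a.monotone hk) fun x hx => (a N).2 x fun z hz => ?_⟩
  refine hYX z (fun y hy => ?_) _ ⟨k, x, hx, rfl⟩
  obtain ⟨x, hx, rfl⟩ := hN y hy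
  exact hz x hx

lemma isDivisorial_span_singleton [IsDomain D] [IsFractionRing D K] {a : D} (ha : a ≠ 0) :
    IsDivisorial K (Ideal.span {a}) := by
  intro x hx
  have ha' : algebraMap D K a ≠ 0 := (map_ne_zero_iff _ (IsFractionRing.injective D K)).2 ha
  obtain ⟨r, hr⟩ := hx (algebraMap D K a)⁻¹ fun y hy => by
    obtain ⟨c, rfl⟩ := Ideal.mem_span_singleton'.1 hy
    exact ⟨c, by rw [map_mul, mul_comm, mul_assoc, mul_inv_cancel₀ ha', mul_one]⟩
  refine Ideal.mem_span_singleton'.2 ⟨r, IsFractionRing.injective D K ?_⟩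
  rw [map_mul, hr, mul_comm, mul_inv_cancel_left₀ ha']

/-- A maximal element among the proper divisorial ideals is prime. -/
lemma isPrime_of_maximal_isDivisorial {P : Ideal D}
    (hP : Maximal (fun I : Ideal D => IsDivisorial K I ∧ I ≠ ⊤) P) : P.IsPrime := by
  refine ⟨hP.1.2, fun {x y} hxy => ?_⟩
  by_contra! hc
  -- `Q = (P : x)` is divisorial and contains `P`, hence equals `P`
  let Q : Ideal D := Submodule.comap (LinearMap.mulLeft D x) P
  have hQ : IsDivisorial K Q := by
    intro w hw
    refine hP.1.1 _ fun z hz => ?_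
    change z * algebraMap D K (x * w) ∈ _
    rw [map_mul, ← mul_assoc]
    refine hw _ fun v hv => ?_
    rw [mul_assoc, ← map_mul]
    exact hz _ hv
  have hle : P ≤ Q := fun w hw => P.mul_mem_left x hw
  have hQt : Q ≠ ⊤ := fun h => by
    have : (1 : D) ∈ Q := h ▸ Submodule.mem_top
    exact hc.1 (by simpa [Q] using this)
  exact hc.2 (hP.2 ⟨hQ, hQt⟩ hle hxy)

/-- A Mori domain whose non-zero primes have a common non-zero element is semilocal: the maximal
elements among the proper divisorial ideals are finitely many primes, and by prime avoidance a
maximal ideal which is none of them contains a non-zero element outside of all of them, although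
principal ideals are divisorial. -/
lemma finite_isMaximal [IsDomain D] [IsFractionRing D K]
    (hD : HasFiniteColons (Set.range (algebraMap D K))) {t : D} (ht : t ≠ 0)
    (htP : ∀ P : Ideal D, P.IsPrime → P ≠ ⊥ → t ∈ P) :
    {I : Ideal D | I.IsMaximal}.Finite := by
  have hwf := (wellFoundedGT_isDivisorial hD).wf
  let Ω : Set (Ideal D) := {P | Maximal (fun I : Ideal D => IsDivisorial K I ∧ I ≠ ⊤) P ∧ P ≠ ⊥}
  have hprime : ∀ P ∈ Ω, P.IsPrime := fun P hP => isPrime_of_maximal_isDivisorial hP.1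
  have hfin : Ω.Finite := finite_of_isDivisorial hD ht hprime (fun P hP => hP.1.1.1)
    (fun P hP => htP P (hprime P hP) hP.2) fun P hP Q hQ h => le_antisymm h (hP.1.2 hQ.1.1 h)
  have hcover : ∀ a : D, a ≠ 0 → ¬ IsUnit a → ∃ P ∈ Ω, a ∈ P := by
    intro a ha hau
    obtain ⟨P, ⟨haP, hPt⟩, hmin⟩ := hwf.has_min
      {I : {I : Ideal D // IsDivisorial K I} | a ∈ I.1 ∧ I.1 ≠ ⊤}
      ⟨⟨_, isDivisorial_span_singleton ha⟩, Ideal.mem_span_singleton_self a,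
        fun h => hau (Ideal.span_singleton_eq_top.1 h)⟩
    refine ⟨P.1, ⟨⟨⟨P.2, hPt⟩, fun I hI hPI => ?_⟩, fun h => ha ?_⟩, haP⟩
    · by_contra hn
      exact hmin ⟨I, hI.1⟩ ⟨hPI haP, hI.2⟩ (lt_of_le_not_ge hPI hn)
    · rwa [h, Ideal.mem_bot] at haP
  refine (hfin.union (Set.finite_singleton ⊥)).subset fun Q hQ => ?_
  have hQm : Q.IsMaximal := hQ
  have hnu : ∀ a ∈ Q, ¬ IsUnit a := fun a ha h => hQm.ne_top (Ideal.eq_top_of_isUnit_mem _ ha h)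
  by_cases hQ0 : Q = ⊥
  · exact Or.inr hQ0
  refine Or.inl ?_
  obtain ⟨a, ha, ha0⟩ := Submodule.exists_mem_ne_zero_of_ne_bot hQ0
  obtain ⟨P₀, hP₀, -⟩ := hcover a ha0 (hnu a ha)
  by_cases hsub : (Q : Set D) ⊆ ⋃ P ∈ (hfin.toFinset : Set (Ideal D)), (P : Set D)
  · obtain ⟨P, hP, hQP⟩ := (Ideal.subset_union_prime (f := fun P => P) ⊥ ⊥
      fun P hP _ _ => hprime P (hfin.mem_toFinset.1 hP)).1 hsub
    have hP' := hfin.mem_toFinset.1 hP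
    rw [hQm.eq_of_le hP'.1.1.2 hQP]
    exact hP'
  · obtain ⟨b, hb, hbn⟩ := Set.not_subset.1 hsub
    have hb' : ∀ P ∈ Ω, b ∉ P := fun P hP h =>
      hbn (Set.mem_biUnion (Finset.mem_coe.2 (hfin.mem_toFinset.2 hP)) h)
    obtain ⟨P, hP, hbP⟩ := hcover b (fun h => hb' P₀ hP₀ (h ▸ zero_mem _)) (hnu b hb)
    exact absurd hbP (hb' P hP)

end Divisorial

/-! ### Stable maximal ideals -/

section Stable

variable {R : Type u} [CommRing R] {K : Type v} [Field K] [Algebra R K]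

/-- The elements `q` of `K` with `q m ⊆ (m : m)`. -/
def stableInverse (K : Type v) [Field K] [Algebra R K] (m : Ideal R) : Set K :=
  {q | ∀ y ∈ m, ∀ z ∈ m, q * algebraMap R K y * algebraMap R K z ∈ IsLocalization.coeSubmodule K m}

lemma mem_coeSubmodule_map {m : Ideal R} {y : R} (hy : y ∈ m) :
    algebraMap R K y ∈ IsLocalization.coeSubmodule K m := ⟨y, hy, rfl⟩

/-- If `m` is invertible as an ideal of `(m : m)`, then `1` is a sum of products of elements of `m`
and of its inverse. -/
lemma IsStableIdeal.one_mem_span {m : Ideal R} (h : IsStableIdeal K m) :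
    (1 : K) ∈ Submodule.span R
      {x | ∃ y ∈ m, ∃ q ∈ stableInverse K m, x = algebraMap R K y * q} := by
  obtain ⟨-, u, hu⟩ := h
  set I : FractionalIdeal (endoRing K m)⁰ K := ↑(m.map (algebraMap R (endoRing K m)))
  let J : FractionalIdeal (endoRing K m)⁰ K := (u⁻¹ : (FractionalIdeal (endoRing K m)⁰ K)ˣ)
  have hIJ : I * J = 1 := by rw [← hu]; exact u.mul_inv
  have hmI : ∀ y ∈ m, algebraMap R K y ∈ I := fun y hy =>
    (FractionalIdeal.mem_coeIdeal _).2
      ⟨algebraMap R (endoRing K m) y, Ideal.mem_map_of_mem _ hy, rfl⟩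
  have hJ : ∀ b ∈ J, b ∈ stableInverse K m := by
    intro b hb y hy z hz
    have h1 : algebraMap R K y * b ∈ (1 : FractionalIdeal (endoRing K m)⁰ K) :=
      hIJ ▸ FractionalIdeal.mul_mem_mul (hmI y hy) hb
    obtain ⟨t, ht⟩ := (FractionalIdeal.mem_one_iff _).1 h1
    rw [mul_comm b, ← ht]
    exact t.2 _ (mem_coeSubmodule_map hz)
  have h1 : (1 : K) ∈ I * J := by rw [hIJ]; exact FractionalIdeal.one_mem_one _
  refine FractionalIdeal.mul_induction_on h1 ?_ fun x y hx hy => add_mem hx hy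
  intro a ha b hb
  obtain ⟨a, ha', rfl⟩ := (FractionalIdeal.mem_coeIdeal _).1 ha
  have key : ∀ c ∈ J, algebraMap (endoRing K m) K a * c ∈ Submodule.span R
      {x | ∃ y ∈ m, ∃ q ∈ stableInverse K m, x = algebraMap R K y * q} := by
    refine Submodule.span_induction ?_ ?_ ?_ ?_ ha'
    · rintro _ ⟨y, hy, rfl⟩ c hc
      exact Submodule.subset_span ⟨y, hy, c, hJ c hc, rfl⟩
    · intro c _
      rw [map_zero, zero_mul]
      exact zero_mem _
    · intro x y _ _ hx hy c hc
      rw [map_add, add_mul]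
      exact add_mem (hx c hc) (hy c hc)
    · intro t x _ hx c hc
      rw [smul_eq_mul, map_mul, mul_comm (algebraMap (endoRing K m) K t), mul_assoc]
      refine hx _ ?_
      rw [← Algebra.smul_def]
      exact Submodule.smul_mem (J : Submodule (endoRing K m) K) t hc
  exact key b hb

/-- Induction on the representation of `1` as a sum of products. -/
lemma IsStableIdeal.one_mem_of {m : Ideal R} (h : IsStableIdeal K m) {N : Submodule R K}
    (hN : ∀ y ∈ m, ∀ q ∈ stableInverse K m, algebraMap R K y * q ∈ N) : (1 : K) ∈ N := by
  refine Submodule.span_le.2 ?_ h.one_mem_span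
  rintro _ ⟨y, hy, q, hq, rfl⟩
  exact hN y hy q hq

variable [IsFractionRing R K]

/-- A stable maximal ideal is divisorial: otherwise `(R : m) = R`, so that `(m : m) = R` and `m`
would be invertible with inverse `R`. -/
lemma IsStableIdeal.isDivisorial {m : Ideal R} [hm : m.IsMaximal] (h : IsStableIdeal K m) :
    IsDivisorial K m := by
  intro x hx
  by_contra hxm
  -- if `m` is not divisorial, then `(R : m) = R`, because `m + x R = R`
  have hcolon : ∀ z : K, (∀ y ∈ m, z * algebraMap R K y ∈ Set.range (algebraMap R K)) →
      z ∈ Set.range (algebraMap R K) := by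
    intro z hz
    obtain ⟨r, a, ha, hra⟩ := hm.exists_inv hxm
    have : z = algebraMap R K r * (z * algebraMap R K x) + z * algebraMap R K a := by
      have h1 := congrArg (algebraMap R K) hra
      rw [map_add, map_mul, map_one] at h1
      linear_combination -z * h1
    rw [this]
    obtain ⟨b, hb⟩ := hx z hz
    obtain ⟨c, hc⟩ := hz a ha
    exact ⟨r * b + c, by rw [map_add, map_mul, hb, hc]⟩
  have h1 : (1 : K) ∈ IsLocalization.coeSubmodule K m := by
    refine h.one_mem_of fun y hy q hq => ?_
    obtain ⟨r, rfl⟩ := hcolon q fun y hy => hcolon _ fun z hz => by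
      obtain ⟨w, -, hw⟩ := hq y hy z hz
      exact ⟨w, hw⟩
    exact ⟨y * r, m.mul_mem_right _ hy, map_mul (algebraMap R K) y r⟩
  obtain ⟨r, hr, hr1⟩ := h1
  have : r = 1 := IsFractionRing.injective R K (hr1.trans (map_one _).symm)
  exact hm.ne_top ((Ideal.eq_top_iff_one m).2 (this ▸ hr))

end Stable

/-! ### Existence of local parameters -/

section Local

variable {R : Type u} [CommRing R] {K : Type v} [Field K] [Algebra R K]

/-- The overring `(M : M)` of the localization of `R` at `m`, where `M` is its maximal ideal. -/
def localEndoRing (K : Type v) [Field K] [Algebra R K] (m : Ideal R) [m.IsPrime] :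
    Subalgebra R K where
  carrier := {x | ∀ y ∈ localizedAt m (IsLocalization.coeSubmodule K m),
    x * y ∈ localizedAt m (IsLocalization.coeSubmodule K m)}
  mul_mem' {a b} ha hb y hy := by
    rw [mul_assoc]
    exact ha _ (hb _ hy)
  add_mem' {a b} ha hb y hy := by
    rw [add_mul]
    exact Submodule.add_mem _ (ha _ hy) (hb _ hy)
  algebraMap_mem' r y hy := by
    rw [← Algebra.smul_def]
    exact Submodule.smul_mem _ _ hy

variable {m : Ideal R} [m.IsPrime]

/-- The localization of `R` at `m` is contained in `(M : M)`. -/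
lemma localizedAt_one_le :
    localizedAt m (1 : Submodule R K) ≤ Subalgebra.toSubmodule (localEndoRing K m) := by
  rintro x ⟨s, hs, hx⟩ y ⟨t, ht, y', hy', hty⟩
  obtain ⟨r, hr⟩ := Submodule.mem_one.1 hx
  refine ⟨s * t, fun h => (Ideal.IsPrime.mem_or_mem ‹_› h).elim hs ht, r * y',
    m.mul_mem_left _ hy', ?_⟩
  rw [← smul_mul_smul_comm, ← hr, ← hty, Algebra.linearMap_apply, Algebra.linearMap_apply]
  exact map_mul (algebraMap R K) r y'

/-- The maximal ideal of the localization of `R` at `m`, as an ideal of `(M : M)`. -/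
def localMaximalIdeal (K : Type v) [Field K] [Algebra R K] (m : Ideal R) [m.IsPrime] :
    Ideal (localEndoRing K m) where
  carrier := {x | (x : K) ∈ localizedAt m (IsLocalization.coeSubmodule K m)}
  zero_mem' := Submodule.zero_mem (localizedAt m (IsLocalization.coeSubmodule K m))
  add_mem' ha hb := Submodule.add_mem (localizedAt m (IsLocalization.coeSubmodule K m)) ha hb
  smul_mem' c _ hx := c.2 _ hx

lemma hasFiniteColons_localEndoRing
    (h : HasFiniteColons (Set.range (algebraMap R K))) (hdiv : IsDivisorial K m) :
    HasFiniteColons (Set.range (algebraMap (localEndoRing K m) K)) := by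
  have h1 : HasFiniteColons (IsLocalization.coeSubmodule K m : Set K) := by
    convert! h.colon {z | ∀ y ∈ m, z * algebraMap R K y ∈ Set.range (algebraMap R K)} using 1
    ext x
    constructor
    · rintro ⟨y, hy, rfl⟩ z hz
      rw [mul_comm]
      exact hz y hy
    · intro hx
      obtain ⟨y, rfl⟩ : x ∈ Set.range (algebraMap R K) := by
        simpa using hx 1 fun y _ => ⟨y, (one_mul _).symm⟩
      exact mem_coeSubmodule_map (hdiv y fun z hz => by
        rw [mul_comm]
        exact hx z hz)
  convert! (h1.localizedAt m).colon (localizedAt m (IsLocalization.coeSubmodule K m)) using 1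
  ext x
  exact ⟨fun ⟨y, hy⟩ => hy ▸ y.2, fun hx => ⟨⟨x, hx⟩, rfl⟩⟩

variable [IsFractionRing R K]

/-- The inverse of `m` in `(m : m)` yields the inverse of `M` in `(M : M)`. -/
lemma IsStableIdeal.localMaximalIdeal_mul_inv (h : IsStableIdeal K m) :
    (localMaximalIdeal K m : FractionalIdeal (localEndoRing K m)⁰ K) *
      (1 / (localMaximalIdeal K m : FractionalIdeal (localEndoRing K m)⁰ K)) = 1 := by
  set I : FractionalIdeal (localEndoRing K m)⁰ K := ↑(localMaximalIdeal K m) with hI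
  have hmI : ∀ y ∈ m, algebraMap R K y ∈ I := fun y hy =>
    (FractionalIdeal.mem_coeIdeal _).2
      ⟨algebraMap R (localEndoRing K m) y, le_localizedAt (mem_coeSubmodule_map hy), rfl⟩
  obtain ⟨y₀, hy₀, hy₀'⟩ := Submodule.exists_mem_ne_zero_of_ne_bot h.1
  have hI0 : I ≠ 0 := by
    intro h0
    have := hmI y₀ hy₀
    rw [h0, FractionalIdeal.mem_zero_iff] at this
    exact hy₀' (IsFractionRing.injective R K (this.trans (map_zero _).symm))
  refine le_antisymm (FractionalIdeal.mul_one_div_le_one) ?_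
  rw [FractionalIdeal.one_le]
  have key : (1 : K) ∈ ((I * (1 / I) : FractionalIdeal (localEndoRing K m)⁰ K) :
      Submodule (localEndoRing K m) K).restrictScalars R := by
    refine h.one_mem_of fun y hy q hq => ?_
    refine FractionalIdeal.mul_mem_mul (hmI y hy)
      ((FractionalIdeal.mem_div_iff_of_ne_zero hI0).2 ?_)
    intro x hx
    obtain ⟨⟨x, hxS⟩, ⟨s, hs, x', hx', hsx⟩, rfl⟩ := (FractionalIdeal.mem_coeIdeal _).1 hx
    refine (FractionalIdeal.mem_one_iff _).2 ⟨⟨q * x, ?_⟩, rfl⟩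
    rintro z ⟨t, ht, z', hz', htz⟩
    refine ⟨s * t, fun h => (Ideal.IsPrime.mem_or_mem ‹_› h).elim hs ht, ?_⟩
    have : (s * t) • (q * x * z) = q * algebraMap R K x' * algebraMap R K z' := by
      rw [Algebra.linearMap_apply] at hsx htz
      rw [hsx, htz, Algebra.smul_def, Algebra.smul_def, Algebra.smul_def, map_mul]
      ring
    rw [this]
    exact hq x' hx' z' hz'
  exact key

variable [IsDomain R]

/-- A non-zero conductor of the complete integral closure of the localization at `m` bounds the
denominators of `(M : M)`, which consists of almost integral elements. -/
lemma exists_mul_mem_localizedAt (hm : m ≠ ⊥) (L : Type*) [CommRing L] [IsDomain L] [Algebra R L]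
    [IsLocalization.AtPrime L m] (K' : Type*) [Field K'] [Algebra L K'] [IsFractionRing L K']
    (hc : completeConductor L K' ≠ ⊥) :
    ∃ f : K, f ≠ 0 ∧ ∀ x ∈ localEndoRing K m, f * x ∈ localizedAt m (1 : Submodule R K) := by
  have hinj := IsFractionRing.injective R K
  have hunit : ∀ y : m.primeCompl, IsUnit (algebraMap R K y) := fun y =>
    ((map_ne_zero_iff _ hinj).2 fun h : (y : R) = 0 => y.2 (h ▸ m.zero_mem)).isUnit
  let _ : Algebra L K := (IsLocalization.lift (M := m.primeCompl) (S := L) hunit).toAlgebra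
  have : IsScalarTower R L K := IsScalarTower.of_algebraMap_eq fun x =>
    (IsLocalization.lift_eq hunit x).symm
  have : IsFractionRing L K :=
    IsFractionRing.isFractionRing_of_isDomain_of_isLocalization m.primeCompl L K
  let e : K ≃ₐ[L] K' := IsLocalization.algEquiv L⁰ K K'
  have hloc : ∀ x : K, x ∈ localizedAt m (1 : Submodule R K) ↔ x ∈ Set.range (algebraMap L K) := by
    intro x
    constructor
    · rintro ⟨s, hs, hx⟩
      obtain ⟨r, hr⟩ := Submodule.mem_one.1 hx
      refine ⟨IsLocalization.mk' L r (⟨s, hs⟩ : m.primeCompl), ?_⟩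
      refine mul_left_cancel₀ (hunit ⟨s, hs⟩).ne_zero ?_
      change algebraMap R K s * _ = algebraMap R K s * x
      rw [← Algebra.smul_def s x, ← hr, IsScalarTower.algebraMap_apply R L K s, ← map_mul,
        mul_comm, IsLocalization.mk'_spec L r (⟨s, hs⟩ : m.primeCompl),
        ← IsScalarTower.algebraMap_apply]
    · rintro ⟨l, rfl⟩
      obtain ⟨⟨r, s⟩, hrs⟩ := IsLocalization.surj m.primeCompl l
      refine ⟨s, s.2, Submodule.mem_one.2 ⟨r, ?_⟩⟩
      rw [Algebra.smul_def, IsScalarTower.algebraMap_apply R L K,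
        IsScalarTower.algebraMap_apply R L K, ← map_mul, ← hrs, mul_comm]
  obtain ⟨f', hf', hf0⟩ := Submodule.exists_mem_ne_zero_of_ne_bot hc
  obtain ⟨y, hy, hy0⟩ := Submodule.exists_mem_ne_zero_of_ne_bot hm
  refine ⟨e.symm f', (map_ne_zero_iff _ e.symm.injective).2 hf0, fun x hx => ?_⟩
  have hpow : ∀ n : ℕ, algebraMap R K y * x ^ n ∈ localizedAt m (1 : Submodule R K) := by
    intro n
    have : algebraMap R K y * x ^ n ∈ localizedAt m (IsLocalization.coeSubmodule K m) := by
      rw [mul_comm]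
      exact (pow_mem hx n : x ^ n ∈ localEndoRing K m) _ (le_localizedAt (mem_coeSubmodule_map hy))
    obtain ⟨s, hs, z, -, hz⟩ := this
    exact ⟨s, hs, Submodule.mem_one.2 ⟨z, hz⟩⟩
  have hex : e x ∈ completeIntegralClosure L K' := by
    refine ⟨algebraMap R L y, mem_nonZeroDivisors_of_ne_zero fun h => hy0 (hinj ?_), fun n => ?_⟩
    · rw [IsScalarTower.algebraMap_apply R L K, h, map_zero, map_zero]
    · obtain ⟨l, hl⟩ := (hloc _).1 (hpow n)
      refine ⟨l, ?_⟩
      rw [← map_pow, ← map_smul, Algebra.smul_def, ← IsScalarTower.algebraMap_apply, ← hl,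
        AlgEquiv.commutes]
  obtain ⟨l, hl⟩ := mem_one_div_iff.1 hf' _ hex
  rw [hloc]
  refine ⟨l, e.injective ?_⟩
  rw [map_mul, AlgEquiv.apply_symm_apply, ← hl, AlgEquiv.commutes]

variable [Ring.KrullDimLE 1 R]

/-- If the overring `(M : M)` has a non-zero conductor to the localization of `R` at `m`, then
every one of its non-zero primes contains `m`: its contraction to `R` is non-zero and contained in
`m`, hence equal to `m`. -/
lemma mem_of_isPrime_localEndoRing {f : K} (hf0 : f ≠ 0)
    (hf : ∀ x ∈ localEndoRing K m, f * x ∈ localizedAt m (1 : Submodule R K))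
    {Q : Ideal (localEndoRing K m)} (hQ : Q.IsPrime) (hQ0 : Q ≠ ⊥) {t : R} (ht : t ∈ m) :
    algebraMap R (localEndoRing K m) t ∈ Q := by
  have hinj := IsFractionRing.injective R K
  have hfS : f ∈ localEndoRing K m :=
    localizedAt_one_le (by simpa using hf 1 (one_mem _))
  obtain ⟨q, hq, hq0⟩ := Submodule.exists_mem_ne_zero_of_ne_bot hQ0
  obtain ⟨s, hs, hsq⟩ := hf q q.2
  obtain ⟨r, hr⟩ := Submodule.mem_one.1 hsq
  let P : Ideal R := Q.comap (algebraMap R (localEndoRing K m))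
  have hrP : r ∈ P := by
    have : algebraMap R (localEndoRing K m) r = s • (⟨f, hfS⟩ * q) := Subtype.ext hr
    change algebraMap R (localEndoRing K m) r ∈ Q
    rw [this, Algebra.smul_def]
    exact Q.mul_mem_left _ (Q.mul_mem_left _ hq)
  have hs0 : s ≠ 0 := fun h => hs (h ▸ m.zero_mem)
  have hr0 : r ≠ 0 := by
    rintro rfl
    rw [map_zero, Algebra.smul_def] at hr
    have hq0' : (q : K) ≠ 0 := fun h => hq0 (Subtype.ext h)
    exact mul_ne_zero ((map_ne_zero_iff _ hinj).2 hs0) (mul_ne_zero hf0 hq0') hr.symm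
  have hPm : P ≤ m := by
    intro u hu
    by_contra hum
    have hu0 : algebraMap R K u ≠ 0 :=
      (map_ne_zero_iff _ hinj).2 fun h => hum (h ▸ m.zero_mem)
    have hinv : (algebraMap R K u)⁻¹ ∈ localEndoRing K m := by
      refine localizedAt_one_le ⟨u, hum, Submodule.mem_one.2 ⟨1, ?_⟩⟩
      rw [map_one, Algebra.smul_def, mul_inv_cancel₀ hu0]
    have h1 : (⟨_, hinv⟩ : localEndoRing K m) * algebraMap R (localEndoRing K m) u = 1 :=
      Subtype.ext (inv_mul_cancel₀ hu0)
    exact hQ.ne_top ((Ideal.eq_top_iff_one Q).2 (h1 ▸ Q.mul_mem_left _ hu))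
  have hPp : P.IsPrime := Ideal.comap_isPrime _ _
  have hPmax : P.IsMaximal := Ideal.isMaximal_of_isPrime_of_ne_bot P fun h => by
    rw [h, Ideal.mem_bot] at hrP
    exact hr0 hrP
  have : t ∈ P := hPmax.eq_of_le (Ideal.IsPrime.ne_top inferInstance) hPm ▸ ht
  exact this

/-- The maximal ideal `M` of the localization at `m` is a principal ideal of the semilocal ring
`(M : M)`, and a generator `α` satisfies `M ^ 2 = α M`. -/
lemma exists_sq_le_component [m.IsMaximal] (h : IsStableIdeal K m)
    (hR : HasFiniteColons (Set.range (algebraMap R K))) {f : K} (hf0 : f ≠ 0)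
    (hf : ∀ x ∈ localEndoRing K m, f * x ∈ localizedAt m (1 : Submodule R K)) :
    ∃ α ∈ m, α ≠ 0 ∧ m ^ 2 ≤ component m (Ideal.span {α} * m) := by
  have hinj := IsFractionRing.injective R K
  obtain ⟨t, ht, ht0⟩ := Submodule.exists_mem_ne_zero_of_ne_bot h.1
  have hfin := finite_isMaximal (hasFiniteColons_localEndoRing hR h.isDivisorial)
    (t := algebraMap R (localEndoRing K m) t)
    (fun h0 => ht0 (hinj ((congrArg Subtype.val h0).trans (map_zero _).symm)))
    fun Q hQ hQ0 => mem_of_isPrime_localEndoRing hf0 hf hQ hQ0 ht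
  obtain ⟨g, hg⟩ := (FractionalIdeal.isPrincipal.of_finite_maximals_of_inv le_rfl hfin _ _
    h.localMaximalIdeal_mul_inv).principal
  have hgen : ∀ x ∈ localizedAt m (IsLocalization.coeSubmodule K m),
      ∃ σ ∈ localEndoRing K m, x = σ * g := by
    intro x hx
    have hxS : x ∈ localEndoRing K m := by
      refine localizedAt_one_le ?_
      obtain ⟨s, hs, y, -, hy⟩ := hx
      exact ⟨s, hs, Submodule.mem_one.2 ⟨y, hy⟩⟩
    have hx' : x ∈ ((localMaximalIdeal K m : FractionalIdeal (localEndoRing K m)⁰ K) :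
        Submodule (localEndoRing K m) K) :=
      (FractionalIdeal.mem_coeIdeal _).2 ⟨⟨x, hxS⟩, hx, rfl⟩
    rw [hg] at hx'
    obtain ⟨σ, hσ⟩ := Submodule.mem_span_singleton.1 hx'
    exact ⟨σ, σ.2, hσ.symm⟩
  have hgM : g ∈ localizedAt m (IsLocalization.coeSubmodule K m) := by
    have hg' : g ∈ ((localMaximalIdeal K m : FractionalIdeal (localEndoRing K m)⁰ K) :
        Submodule (localEndoRing K m) K) := hg ▸ Submodule.mem_span_singleton_self g
    obtain ⟨x, hx, rfl⟩ := (FractionalIdeal.mem_coeIdeal _).1 hg'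
    exact hx
  obtain ⟨s, hs, α, hα, hsα⟩ := hgM
  rw [Algebra.linearMap_apply] at hsα
  refine ⟨α, hα, ?_, ?_⟩
  · rintro rfl
    rw [map_zero, Algebra.smul_def, eq_comm, mul_eq_zero] at hsα
    rcases hsα with h0 | h0
    · exact hs ((map_eq_zero_iff _ hinj).1 h0 ▸ m.zero_mem)
    · obtain ⟨σ, -, hσ⟩ := hgen _ (le_localizedAt (mem_coeSubmodule_map ht))
      rw [h0, mul_zero] at hσ
      exact ht0 ((map_eq_zero_iff _ hinj).1 hσ)
  · rw [pow_two, Ideal.mul_le]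
    intro x hx y hy
    obtain ⟨σ, hσ, hxσ⟩ := hgen _ (le_localizedAt (mem_coeSubmodule_map hx))
    obtain ⟨t, ht, w, hw, htw⟩ := hσ _ (le_localizedAt (mem_coeSubmodule_map hy))
    rw [Algebra.linearMap_apply] at htw
    refine ⟨s * t, fun h => (Ideal.IsPrime.mem_or_mem inferInstance h).elim hs ht, ?_⟩
    have : s * t * (x * y) = α * w := hinj (by
      rw [map_mul, map_mul, map_mul, map_mul, hsα, htw, hxσ, Algebra.smul_def, Algebra.smul_def]
      ring)
    rw [this]
    exact Ideal.mul_mem_mul (Ideal.mem_span_singleton_self α) hw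

end Local

section Global

variable {R : Type u} [CommRing R] [IsDomain R] [Ring.KrullDimLE 1 R]

lemma mem_minimalNonzeroPrimes_iff (hR : ¬ IsField R) {m : Ideal R} :
    m ∈ minimalNonzeroPrimes R ↔ m.IsMaximal := by
  constructor
  · rintro ⟨⟨h1, h2⟩, -⟩
    exact Ideal.isMaximal_of_isPrime_of_ne_bot m h2
  · intro h
    refine ⟨⟨h.isPrime, Ring.ne_bot_of_isMaximal_of_not_isField h hR⟩, fun Q hQ hQm => ?_⟩
    obtain ⟨hQ1, hQ2⟩ := hQ
    have := Ideal.isMaximal_of_isPrime_of_ne_bot Q hQ2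
    exact (this.eq_of_le h.ne_top hQm).ge

/-- The algebra structure that instance search finds here is the lift of `R → FractionRing R_m`. It
agrees with the canonical one, so `FractionRing R_m` is a fraction field of `R_m` for it too. -/
lemma isFractionRing_localizationAtPrime {R : Type u} [CommRing R] [IsDomain R] (m : Ideal R)
    [m.IsPrime] :
    IsFractionRing (Localization.AtPrime m) (FractionRing (Localization.AtPrime m)) := by
  have h : (inferInstance : Algebra (Localization.AtPrime m)
      (FractionRing (Localization.AtPrime m))) = OreLocalization.instAlgebra := by
    refine Algebra.algebra_ext _ _ fun x => ?_
    refine RingHom.congr_fun (IsLocalization.ringHom_ext m.primeCompl (RingHom.ext fun r => ?_)) x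
    exact IsLocalization.lift_eq _ r
  unfold IsFractionRing
  have key := Localization.isLocalization (M := nonZeroDivisors (Localization.AtPrime m))
  convert key

/-- In a one-dimensional Mori domain the maximal ideals are divisorial as soon as they are stable,
hence every non-zero element lies in only finitely many of them. -/
lemma exists_localParameters (hR : ¬ IsField R) (hMori : IsMoriDomain R (FractionRing R))
    (hstable : ∀ m ∈ minimalNonzeroPrimes R, IsStableIdeal (FractionRing R) m)
    (hcond : ∀ (m : Ideal R) [m.IsPrime], m ∈ minimalNonzeroPrimes R →
      completeConductor (Localization.AtPrime m) (FractionRing (Localization.AtPrime m)) ≠ ⊥) :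
    Nonempty (LocalParameters R) := by
  have hstable' : ∀ m : MaximalSpectrum R, IsStableIdeal (FractionRing R) m.asIdeal := fun m =>
    hstable _ ((mem_minimalNonzeroPrimes_iff hR).2 m.isMaximal)
  have hfc := hMori.hasFiniteColons
  have key : ∀ m : MaximalSpectrum R, ∃ α ∈ m.asIdeal, α ≠ 0 ∧
      m.asIdeal ^ 2 ≤ component m.asIdeal (Ideal.span {α} * m.asIdeal) := by
    intro m
    have := isFractionRing_localizationAtPrime m.asIdeal
    obtain ⟨f, hf0, hf⟩ := exists_mul_mem_localizedAt (K := FractionRing R) (hstable' m).1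
      (Localization.AtPrime m.asIdeal) (FractionRing (Localization.AtPrime m.asIdeal))
      (hcond m.asIdeal ((mem_minimalNonzeroPrimes_iff hR).2 m.isMaximal))
    exact exists_sq_le_component (hstable' m) hfc hf0 hf
  choose α hα hα0 hsq using key
  refine ⟨⟨α, hα, hα0, hsq, fun x hx => ?_⟩⟩
  have hfin := finite_of_isDivisorial hfc hx
    (Ω := MaximalSpectrum.asIdeal '' {m : MaximalSpectrum R | x ∈ m.asIdeal})
    (by rintro _ ⟨m, -, rfl⟩; infer_instance)
    (by rintro _ ⟨m, -, rfl⟩; exact (hstable' m).isDivisorial)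
    (by rintro _ ⟨m, hm, rfl⟩; exact hm)
    (by
      rintro _ ⟨m, -, rfl⟩ _ ⟨n, -, rfl⟩ h
      exact m.isMaximal.eq_of_le n.isMaximal.ne_top h)
  exact hfin.of_finite_image fun m _ n _ h => MaximalSpectrum.ext h

end Global

/-! ### Primes of the complete integral closure in the half-factorial case -/

/-- Non-zero primes of the complete integral closure contract to non-zero primes. -/
lemma comap_ne_bot {R : Type u} [CommRing R] [IsDomain R] (K : Type v) [Field K] [Algebra R K]
    [IsFractionRing R K] {P : Ideal (completeIntegralClosure R K)} (hP : P ≠ ⊥) :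
    P.comap (algebraMap R (completeIntegralClosure R K)) ≠ ⊥ := by
  have hinj := IsFractionRing.injective R K
  obtain ⟨x, hx, hx0⟩ := Submodule.exists_mem_ne_zero_of_ne_bot hP
  obtain ⟨a, b, hb, hab⟩ := IsFractionRing.div_surjective R (x : K)
  have hb' : algebraMap R K b ≠ 0 := (map_ne_zero_iff _ hinj).2 (nonZeroDivisors.ne_zero hb)
  have hax : algebraMap R (completeIntegralClosure R K) a =
      algebraMap R (completeIntegralClosure R K) b * x := Subtype.ext (by
    change algebraMap R K a = algebraMap R K b * x
    rw [← hab, mul_div_cancel₀ _ hb'])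
  have haP : a ∈ P.comap (algebraMap R (completeIntegralClosure R K)) := by
    rw [Ideal.mem_comap, hax]
    exact P.mul_mem_left _ hx
  intro h0
  rw [h0, Ideal.mem_bot] at haP
  rw [haP, map_zero, zero_div] at hab
  exact hx0 (Subtype.ext hab.symm)

namespace LocalParameters

variable {R : Type u} [CommRing R] [IsDomain R] [Ring.KrullDimLE 1 R] (A : LocalParameters R)

/-- The `m`-adic order of an element. -/
noncomputable abbrev elementOrder (m : MaximalSpectrum R) (x : R) : ℕ :=
  idealOrder m.asIdeal (Ideal.span {x})

lemma le_elementOrder_iff (A : LocalParameters R) {m : MaximalSpectrum R} {x : R} (hx : x ≠ 0)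
    {k : ℕ} : k ≤ elementOrder m x ↔ x ∈ m.asIdeal ^ k := by
  rw [A.le_idealOrder_iff m (by simpa using hx), Ideal.span_singleton_le_iff_mem]

lemma elementOrder_eq_zero (A : LocalParameters R) {m : MaximalSpectrum R} {x : R}
    (hx : x ∉ m.asIdeal) : elementOrder m x = 0 := by
  by_contra h
  have hx0 : x ≠ 0 := fun h0 => hx (h0 ▸ zero_mem _)
  have := (A.le_elementOrder_iff (m := m) (k := 1) hx0).1 (Nat.one_le_iff_ne_zero.2 h)
  rw [pow_one] at this
  exact hx this

/-- The orders of elements are additive. This is half-factoriality. -/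
def OrderAdditive (R : Type u) [CommRing R] : Prop :=
  ∀ (m : MaximalSpectrum R) (x y : R), x ≠ 0 → y ≠ 0 →
    elementOrder m (x * y) = elementOrder m x + elementOrder m y

variable {m : MaximalSpectrum R}

lemma elementOrder_pow (A : LocalParameters R) (hadd : OrderAdditive R) {x : R} (hx : x ≠ 0)
    (n : ℕ) : elementOrder m (x ^ n) = n * elementOrder m x := by
  induction n with
  | zero =>
    rw [pow_zero, zero_mul]
    exact A.elementOrder_eq_zero ((Ideal.ne_top_iff_one _).1 m.isMaximal.ne_top)
  | succ n ih => rw [pow_succ, hadd m _ _ (pow_ne_zero n hx) hx, ih, Nat.succ_mul]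

/-- If the order of `x` exceeds the order of `y`, then `x ∈ y m` locally at `m`: locally some
power `α ^ n` is a multiple `c * y` of `y`, and then `x * c` has order greater than `n`, so that it
is locally in `m ^ (n + 1) = α ^ n m`. -/
lemma exists_mul_eq_of_elementOrder_lt (A : LocalParameters R) (hadd : OrderAdditive R) {x y : R}
    (hx : x ≠ 0) (hy : y ≠ 0) (h : elementOrder m y < elementOrder m x) :
    ∃ s ∉ m.asIdeal, ∃ z ∈ m.asIdeal, s * x = y * z := by
  obtain ⟨s, hs, n, hn⟩ := exists_mul_pow_mem (I := Ideal.span {y}) (by simpa using hy) (A.mem m)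
  obtain ⟨c, hc⟩ := Ideal.mem_span_singleton'.1 hn
  have hs0 : s ≠ 0 := fun h0 => hs (h0 ▸ zero_mem _)
  have hsα : s * A.α m ^ n ≠ 0 := mul_ne_zero hs0 (pow_ne_zero n (A.ne_zero m))
  have hc0 : c ≠ 0 := by
    rintro rfl
    rw [zero_mul] at hc
    exact hsα hc.symm
  have h1 : n ≤ elementOrder m (c * y) := by
    rw [hc, A.le_elementOrder_iff hsα]
    exact Ideal.mul_mem_left _ _ (Ideal.pow_mem_pow (A.mem m) n)
  rw [hadd m c y hc0 hy] at h1
  have h2 : x * c ∈ m.asIdeal ^ (n + 1) := by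
    rw [← A.le_elementOrder_iff (mul_ne_zero hx hc0), hadd m x c hx hc0]
    omega
  obtain ⟨t, ht, z, hz, htz⟩ := A.exists_of_mem_pow m h2
  refine ⟨s * t, fun h => (Ideal.IsPrime.mem_or_mem inferInstance h).elim hs ht, z, hz,
    mul_right_cancel₀ hc0 ?_⟩
  linear_combination s * htz - z * hc

variable {K : Type v} [Field K] [Algebra R K] [IsFractionRing R K]

/-- Almost integral elements have non-negative orders. -/
lemma elementOrder_le_of_mem_completeIntegralClosure (A : LocalParameters R)
    (hadd : OrderAdditive R) {a b : R} (ha : a ≠ 0) (hb : b ≠ 0)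
    (h : algebraMap R K a / algebraMap R K b ∈ completeIntegralClosure R K) :
    elementOrder m b ≤ elementOrder m a := by
  have hinj := IsFractionRing.injective R K
  obtain ⟨c, hc, hcn⟩ := h
  have hc0 := nonZeroDivisors.ne_zero hc
  have hb' : algebraMap R K b ≠ 0 := (map_ne_zero_iff _ hinj).2 hb
  by_contra! hlt
  set n := elementOrder m c + 1
  obtain ⟨r, hr⟩ := hcn n
  rw [div_pow, Algebra.smul_def, mul_div_assoc', eq_div_iff (pow_ne_zero n hb'), ← map_pow,
    ← map_pow, ← map_mul, ← map_mul] at hr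
  have hr' := hinj hr
  have hr0 : r ≠ 0 := by
    rintro rfl
    rw [zero_mul] at hr'
    exact mul_ne_zero hc0 (pow_ne_zero n ha) hr'.symm
  have h1 := congrArg (elementOrder m) hr'
  rw [hadd m _ _ hr0 (pow_ne_zero n hb), hadd m _ _ hc0 (pow_ne_zero n ha),
    A.elementOrder_pow hadd ha, A.elementOrder_pow hadd hb] at h1
  have h2 : n * (elementOrder m a + 1) ≤ n * elementOrder m b := Nat.mul_le_mul_left n hlt
  rw [mul_add, mul_one] at h2
  omega

/-- Fractions with non-negative orders at all maximal ideals are almost integral: `b * (a / b) ^ n`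
has positive order wherever `b` has. -/
lemma mem_completeIntegralClosure_of_elementOrder_le (A : LocalParameters R)
    (hadd : OrderAdditive R) {a b : R} (ha : a ≠ 0) (hb : b ≠ 0)
    (h : ∀ m : MaximalSpectrum R, elementOrder m b ≤ elementOrder m a) :
    algebraMap R K a / algebraMap R K b ∈ completeIntegralClosure R K := by
  have hinj := IsFractionRing.injective R K
  have hb' : algebraMap R K b ≠ 0 := (map_ne_zero_iff _ hinj).2 hb
  refine ⟨b, mem_nonZeroDivisors_of_ne_zero hb, fun n => ?_⟩
  have hmem : Ideal.span {b * a ^ n} ≤ Ideal.span {b ^ n} := by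
    refine le_of_forall_le_component fun m hm => ?_
    rw [Ideal.span_singleton_le_iff_mem]
    by_cases hbm : b ∈ m
    · have h1 : 1 ≤ elementOrder ⟨m, hm⟩ b := by
        rw [A.le_elementOrder_iff hb, pow_one]
        exact hbm
      have hlt : elementOrder ⟨m, hm⟩ (b ^ n) < elementOrder ⟨m, hm⟩ (b * a ^ n) := by
        rw [hadd _ _ _ hb (pow_ne_zero n ha), A.elementOrder_pow hadd ha,
          A.elementOrder_pow hadd hb]
        have := Nat.mul_le_mul_left n (h ⟨m, hm⟩)
        omega
      obtain ⟨s, hs, z, -, hz⟩ := A.exists_mul_eq_of_elementOrder_lt hadd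
        (mul_ne_zero hb (pow_ne_zero n ha)) (pow_ne_zero n hb) hlt
      exact ⟨s, hs, hz ▸ Ideal.mul_mem_right _ _ (Ideal.mem_span_singleton_self _)⟩
    · exact ⟨b ^ n, fun h => hbm (Ideal.IsPrime.mem_of_pow_mem inferInstance n h),
        Ideal.mul_mem_right _ _ (Ideal.mem_span_singleton_self _)⟩
  obtain ⟨r, hr⟩ := Ideal.mem_span_singleton'.1 ((Ideal.span_singleton_le_iff_mem _).1 hmem)
  refine ⟨r, ?_⟩
  rw [div_pow, Algebra.smul_def, mul_div_assoc', eq_div_iff (pow_ne_zero n hb'), ← map_pow,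
    ← map_pow, ← map_mul, ← map_mul, hr]

/-- A fraction with non-negative order at `m` is locally almost integral: multiply it by an element
outside `m` that lies in high powers of the other maximal ideals containing the denominator. -/
lemma exists_mul_mem_completeIntegralClosure (A : LocalParameters R) (hadd : OrderAdditive R)
    {a b : R} (ha : a ≠ 0) (hb : b ≠ 0) (h : elementOrder m b ≤ elementOrder m a) :
    ∃ s ∉ m.asIdeal, algebraMap R K s * (algebraMap R K a / algebraMap R K b) ∈
      completeIntegralClosure R K := by
  classical
  have hex : ∀ n : MaximalSpectrum R, ∃ s ∉ m.asIdeal, n ≠ m → s ∈ n.asIdeal := fun n => by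
    by_cases hn : n = m
    · exact ⟨1, (Ideal.ne_top_iff_one _).1 m.isMaximal.ne_top, fun h => absurd hn h⟩
    · obtain ⟨s, hs, hsm⟩ := SetLike.not_le_iff_exists.1 fun hle : n.asIdeal ≤ m.asIdeal =>
        hn (MaximalSpectrum.ext (n.isMaximal.eq_of_le m.isMaximal.ne_top hle))
      exact ⟨s, hsm, fun _ => hs⟩
  choose s hs hsn using hex
  let F := (A.finite b hb).toFinset
  let c := ∏ n ∈ F, s n ^ elementOrder n b
  have hc : c ∉ m.asIdeal := fun hc => by
    obtain ⟨n, -, hn⟩ := (Ideal.IsPrime.prod_mem_iff (hp := inferInstance)).1 hc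
    exact hs n (Ideal.IsPrime.mem_of_pow_mem inferInstance _ hn)
  have hc0 : c ≠ 0 := fun h0 => hc (h0 ▸ zero_mem _)
  refine ⟨c, hc, ?_⟩
  rw [mul_div_assoc', ← map_mul]
  refine A.mem_completeIntegralClosure_of_elementOrder_le hadd (mul_ne_zero hc0 ha) hb fun n => ?_
  rw [hadd n c a hc0 ha]
  by_cases hn : n = m
  · subst hn
    omega
  by_cases hnb : b ∈ n.asIdeal
  · have : elementOrder n b ≤ elementOrder n c := by
      rw [A.le_elementOrder_iff hc0]
      refine Ideal.mem_of_dvd _ (Finset.dvd_prod_of_mem _ ((A.finite b hb).mem_toFinset.2 hnb)) ?_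
      exact Ideal.pow_mem_pow (hsn n hn) _
    omega
  · rw [A.elementOrder_eq_zero hnb]
    exact Nat.zero_le _

/-- A prime of the complete integral closure over `m` consists of the elements of positive order
at `m`. -/
lemma mem_iff_of_comap_eq (A : LocalParameters R) (hadd : OrderAdditive R)
    {P : Ideal (completeIntegralClosure R K)} (hP : P.IsPrime)
    (hPm : P.comap (algebraMap R (completeIntegralClosure R K)) = m.asIdeal)
    {x : completeIntegralClosure R K} :
    x ∈ P ↔ ∃ s ∉ m.asIdeal, ∃ z ∈ m.asIdeal, algebraMap R K s * x = algebraMap R K z := by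
  have hinj := IsFractionRing.injective R K
  have hmem : ∀ r, r ∈ m.asIdeal ↔ algebraMap R (completeIntegralClosure R K) r ∈ P := fun r => by
    rw [← hPm, Ideal.mem_comap]
  constructor
  · intro hx
    by_cases hx0 : x = 0
    · refine ⟨1, (Ideal.ne_top_iff_one _).1 m.isMaximal.ne_top, 0, zero_mem _, ?_⟩
      rw [hx0, map_zero]
      exact mul_zero _
    obtain ⟨a, b, hb, hab⟩ := IsFractionRing.div_surjective R (x : K)
    have hb0 := nonZeroDivisors.ne_zero hb
    have hb' : algebraMap R K b ≠ 0 := (map_ne_zero_iff _ hinj).2 hb0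
    have ha0 : a ≠ 0 := by
      rintro rfl
      rw [map_zero, zero_div] at hab
      exact hx0 (Subtype.ext hab.symm)
    have ha' : algebraMap R K a ≠ 0 := (map_ne_zero_iff _ hinj).2 ha0
    have hle := A.elementOrder_le_of_mem_completeIntegralClosure (m := m) hadd ha0 hb0
      (hab ▸ x.2 : algebraMap R K a / algebraMap R K b ∈ completeIntegralClosure R K)
    rcases hle.lt_or_eq with hlt | heq
    · obtain ⟨s, hs, z, hz, hsz⟩ := A.exists_mul_eq_of_elementOrder_lt hadd ha0 hb0 hlt
      refine ⟨s, hs, z, hz, ?_⟩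
      rw [← hab, mul_div_assoc', ← map_mul, hsz, map_mul, mul_div_cancel_left₀ _ hb']
    · obtain ⟨s, hs, hsx⟩ := A.exists_mul_mem_completeIntegralClosure (K := K) hadd hb0 ha0 heq.ge
      refine absurd ((hmem s).2 ?_) hs
      have : algebraMap R (completeIntegralClosure R K) s = ⟨_, hsx⟩ * x := Subtype.ext (by
        change algebraMap R K s =
          algebraMap R K s * (algebraMap R K b / algebraMap R K a) * (x : K)
        rw [← hab]
        field_simp)
      rw [this]
      exact P.mul_mem_left _ hx
  · rintro ⟨s, hs, z, hz, hsz⟩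
    have : algebraMap R (completeIntegralClosure R K) s * x =
        algebraMap R (completeIntegralClosure R K) z := Subtype.ext hsz
    refine (hP.mem_or_mem (this ▸ (hmem z).1 hz)).resolve_left fun h => hs ((hmem s).2 h)

/-- There is a prime of the complete integral closure over every maximal ideal. -/
lemma exists_isPrime_comap_eq (A : LocalParameters R) (hadd : OrderAdditive R)
    (m : MaximalSpectrum R) :
    ∃ P : Ideal (completeIntegralClosure R K), P.IsPrime ∧
      P.comap (algebraMap R (completeIntegralClosure R K)) = m.asIdeal := by
  have hinj := IsFractionRing.injective R K
  set f := algebraMap R (completeIntegralClosure R K) with hf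
  have hloc : ∀ x ∈ m.asIdeal.map f,
      ∃ s ∉ m.asIdeal, ∃ z ∈ m.asIdeal, algebraMap R K s * x = algebraMap R K z := by
    intro x hx
    have hmul : ∀ (y : completeIntegralClosure R K) (z : R), z ∈ m.asIdeal →
        ∃ s ∉ m.asIdeal, ∃ w ∈ m.asIdeal,
          algebraMap R K s * (y * algebraMap R K z) = algebraMap R K w := by
      intro y z hz
      have hone := (Ideal.ne_top_iff_one _).1 m.isMaximal.ne_top
      by_cases hz0 : z = 0
      · exact ⟨1, hone, 0, zero_mem _, by rw [hz0, map_zero, mul_zero, mul_zero]⟩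
      obtain ⟨a, b, hb, hab⟩ := IsFractionRing.div_surjective R (y : K)
      by_cases ha0 : a = 0
      · refine ⟨1, hone, 0, zero_mem _, ?_⟩
        rw [← hab, ha0, map_zero, zero_div, zero_mul, mul_zero]
      have hb0 := nonZeroDivisors.ne_zero hb
      have hb' : algebraMap R K b ≠ 0 := (map_ne_zero_iff _ hinj).2 hb0
      have hle := A.elementOrder_le_of_mem_completeIntegralClosure (m := m) hadd ha0 hb0
        (hab ▸ y.2 : algebraMap R K a / algebraMap R K b ∈ completeIntegralClosure R K)
      have h1 : 1 ≤ elementOrder m z := by rwa [A.le_elementOrder_iff hz0, pow_one]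
      have hlt : elementOrder m b < elementOrder m (a * z) := by
        rw [hadd m a z ha0 hz0]
        omega
      obtain ⟨s, hs, w, hw, hsw⟩ :=
        A.exists_mul_eq_of_elementOrder_lt hadd (mul_ne_zero ha0 hz0) hb0 hlt
      refine ⟨s, hs, w, hw, ?_⟩
      rw [← hab, div_mul_eq_mul_div, ← map_mul, mul_div_assoc', ← map_mul, hsw, map_mul,
        mul_div_cancel_left₀ _ hb']
    refine Submodule.span_induction ?_ ?_ ?_ ?_ hx
    · rintro _ ⟨z, hz, rfl⟩
      obtain ⟨s, hs, w, hw, h⟩ := hmul 1 z hz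
      exact ⟨s, hs, w, hw, by rwa [OneMemClass.coe_one, one_mul] at h⟩
    · refine ⟨1, (Ideal.ne_top_iff_one _).1 m.isMaximal.ne_top, 0, zero_mem _, ?_⟩
      rw [map_zero]
      exact mul_zero _
    · rintro x y - - ⟨s, hs, z, hz, hsz⟩ ⟨t, ht, w, hw, htw⟩
      refine ⟨s * t, fun h => (Ideal.IsPrime.mem_or_mem inferInstance h).elim hs ht, t * z + s * w,
        add_mem (Ideal.mul_mem_left _ _ hz) (Ideal.mul_mem_left _ _ hw), ?_⟩
      change algebraMap R K (s * t) * ((x : K) + y) = _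
      rw [map_mul, map_add, map_mul, map_mul, ← hsz, ← htw]
      ring
    · rintro y x - ⟨s, hs, z, hz, hsz⟩
      obtain ⟨t, ht, w, hw, htw⟩ := hmul y z hz
      refine ⟨t * s, fun h => (Ideal.IsPrime.mem_or_mem inferInstance h).elim ht hs, w, hw, ?_⟩
      change algebraMap R K (t * s) * ((y : K) * x) = _
      rw [← htw, ← hsz, map_mul]
      ring
  -- a prime that contains `m` and avoids the complement of `m` lies over `m`
  have hd : Disjoint (m.asIdeal.map f : Set (completeIntegralClosure R K))
      (m.asIdeal.primeCompl.map f : Submonoid _) := by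
    rw [Set.disjoint_left]
    rintro _ hx ⟨r, hr, rfl⟩
    obtain ⟨s, hs, z, hz, hsz⟩ := hloc _ hx
    have : s * r = z := hinj (by rw [map_mul]; exact hsz)
    exact (Ideal.IsPrime.mem_or_mem inferInstance (this ▸ hz : s * r ∈ m.asIdeal)).elim hs hr
  obtain ⟨P, hP, hmP, hPd⟩ := Ideal.exists_le_prime_disjoint _ _ hd
  refine ⟨P, hP, le_antisymm (fun r hr => ?_) (Ideal.map_le_iff_le_comap.1 hmP)⟩
  by_contra hrm
  exact Set.disjoint_left.1 hPd hr ⟨r, hrm, rfl⟩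

variable (K) in
/-- Contraction of minimal non-zero primes of the complete integral closure is bijective. -/
lemma bijOn_comap (A : LocalParameters R) (hadd : OrderAdditive R) (hR : ¬ IsField R) :
    Set.BijOn (Ideal.comap (algebraMap R (completeIntegralClosure R K)))
      (minimalNonzeroPrimes (completeIntegralClosure R K)) (minimalNonzeroPrimes R) := by
  have hmax : ∀ P : Ideal (completeIntegralClosure R K), P.IsPrime → P ≠ ⊥ →
      (P.comap (algebraMap R (completeIntegralClosure R K))).IsMaximal := fun P hP hP0 =>
    have := Ideal.comap_isPrime (algebraMap R (completeIntegralClosure R K)) P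
    Ideal.isMaximal_of_isPrime_of_ne_bot _ (comap_ne_bot K hP0)
  have huniq : ∀ P Q : Ideal (completeIntegralClosure R K), P.IsPrime → P ≠ ⊥ → Q.IsPrime →
      P.comap (algebraMap R (completeIntegralClosure R K)) =
        Q.comap (algebraMap R (completeIntegralClosure R K)) → P = Q := by
    intro P Q hP hP0 hQ h
    ext x
    rw [A.mem_iff_of_comap_eq (m := ⟨_, hmax P hP hP0⟩) hadd hP rfl,
      A.mem_iff_of_comap_eq (m := ⟨_, hmax P hP hP0⟩) hadd hQ h.symm]
  refine ⟨fun P hP => ?_, fun P hP Q hQ h => huniq P Q hP.1.1 hP.1.2 hQ.1.1 h, fun m hm => ?_⟩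
  · exact (mem_minimalNonzeroPrimes_iff hR).2 (hmax P hP.1.1 hP.1.2)
  · have hm' := (mem_minimalNonzeroPrimes_iff hR).1 hm
    obtain ⟨P, hP, hPm⟩ := A.exists_isPrime_comap_eq (K := K) hadd ⟨m, hm'⟩
    have hP0 : P ≠ ⊥ := by
      rintro rfl
      obtain ⟨t, ht, ht0⟩ := Submodule.exists_mem_ne_zero_of_ne_bot hm.1.2
      have : t ∈ (⊥ : Ideal (completeIntegralClosure R K)).comap
          (algebraMap R (completeIntegralClosure R K)) := hPm ▸ ht
      rw [Ideal.mem_comap, Ideal.mem_bot] at this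
      exact ht0 (IsFractionRing.injective R K ((congrArg Subtype.val this).trans (map_zero _).symm))
    refine ⟨P, ⟨⟨hP, hP0⟩, fun Q hQ hQP => ?_⟩, hPm⟩
    refine (huniq Q P hQ.1 hQ.2 hP ?_).ge
    exact (hmax Q hQ.1 hQ.2).eq_of_le (hPm ▸ hm'.ne_top) (Ideal.comap_mono hQP)

end LocalParameters

/-! ### The two ideal monoids -/

section IdealMonoids

lemma mem_invertibleIdeals_of_mul {R : Type u} [CommRing R] {I J : Ideal R}
    (h : I * J ∈ invertibleIdeals R) :
    I ∈ invertibleIdeals R ∧ J ∈ invertibleIdeals R := by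
  have h' : IsUnit ((I * J : Ideal R) : FractionalIdeal R⁰ (FractionRing R)) := h
  rw [FractionalIdeal.coeIdeal_mul] at h'
  exact ⟨isUnit_of_mul_isUnit_left h', isUnit_of_mul_isUnit_right h'⟩

variable {R : Type u} [CommRing R] [IsDomain R]

lemma ne_bot_of_mem_invertibleIdeals {I : Ideal R} (h : I ∈ invertibleIdeals R) : I ≠ ⊥ := by
  rintro rfl
  have h' : IsUnit (((⊥ : Ideal R)) : FractionalIdeal R⁰ (FractionRing R)) := h
  rw [FractionalIdeal.coeIdeal_bot] at h'
  exact not_isUnit_zero h'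

lemma span_singleton_mem_invertibleIdeals {a : R} (ha : a ≠ 0) :
    Ideal.span {a} ∈ invertibleIdeals R := by
  change IsUnit ((Ideal.span {a} : Ideal R) : FractionalIdeal R⁰ (FractionRing R))
  rw [FractionalIdeal.coeIdeal_span_singleton]
  have h0 : algebraMap R (FractionRing R) a ≠ 0 :=
    (map_ne_zero_iff _ (IsFractionRing.injective R (FractionRing R))).2 ha
  exact .of_mul_eq_one _ (FractionalIdeal.spanSingleton_mul_inv (FractionRing R) h0)

lemma mul_left_cancel_of_mem_invertibleIdeals {I A B : Ideal R} (hI : I ∈ invertibleIdeals R)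
    (h : I * A = I * B) : A = B := by
  have hI' : IsUnit (I : FractionalIdeal R⁰ (FractionRing R)) := hI
  refine FractionalIdeal.coeIdeal_injective (K := FractionRing R) (hI'.mul_left_cancel ?_)
  rw [← FractionalIdeal.coeIdeal_mul, h, FractionalIdeal.coeIdeal_mul]

namespace LocalParameters

variable [Ring.KrullDimLE 1 R] (A : LocalParameters R)

/-- The primary decomposition of non-zero ideals. -/
noncomputable def nonzeroSystem : PrimarySystem (nonzeroIdeals R) (MaximalSpectrum R) :=
  A.primarySystem (nonzeroIdeals R) (fun _ h => h)
    (fun _ _ h => ⟨left_ne_zero_of_mul h, right_ne_zero_of_mul h⟩)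
    fun _ h => mt Ideal.span_singleton_eq_bot.1 h

/-- The primary decomposition of invertible ideals. -/
noncomputable def invertibleSystem : PrimarySystem (invertibleIdeals R) (MaximalSpectrum R) :=
  A.primarySystem (invertibleIdeals R) (fun _ h => ne_bot_of_mem_invertibleIdeals h)
    (fun _ _ h => mem_invertibleIdeals_of_mul h) fun _ h => span_singleton_mem_invertibleIdeals h

/-- The orders are additive on non-zero ideals as soon as they are additive on principal ideals,
which are invertible. -/
lemma isAdditive_nonzeroSystem_iff :
    A.nonzeroSystem.IsAdditive ↔ A.invertibleSystem.IsAdditive := by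
  constructor
  · intro h m I J
    exact h m ⟨I, ne_bot_of_mem_invertibleIdeals I.2⟩ ⟨J, ne_bot_of_mem_invertibleIdeals J.2⟩
  · intro h m I J
    refine idealOrder_mul_of_span m A (fun x y hx hy => ?_) I.2 J.2
    exact h m ⟨_, span_singleton_mem_invertibleIdeals hx⟩
      ⟨_, span_singleton_mem_invertibleIdeals hy⟩

lemma orderAdditive_of_isAdditive (h : A.nonzeroSystem.IsAdditive) : OrderAdditive R := by
  intro m x y hx hy
  have := h m ⟨Ideal.span {x}, mt Ideal.span_singleton_eq_bot.1 hx⟩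
    ⟨Ideal.span {y}, mt Ideal.span_singleton_eq_bot.1 hy⟩
  change idealOrder m.asIdeal (Ideal.span {x} * Ideal.span {y}) = _ at this
  rw [Ideal.span_singleton_mul_span_singleton] at this
  exact this

/-- Chains of factorizations of an invertible ideal in the monoid of all non-zero ideals are enough:
such an ideal is cancellable there, and it has the same size in both monoids. -/
lemma isAdditive_of_catenaryDegree_nonzeroIdeals_le (h : catenaryDegree (nonzeroIdeals R) ≤ 2) :
    A.invertibleSystem.IsAdditive := by
  refine A.invertibleSystem.isAdditive_of_size fun I J => ?_
  exact A.nonzeroSystem.size_mul_of_catenaryDegree_le h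
    (a := ⟨I, ne_bot_of_mem_invertibleIdeals I.2⟩) (b := ⟨J, ne_bot_of_mem_invertibleIdeals J.2⟩)
    fun X Y hXY => Subtype.ext <|
      mul_left_cancel_of_mem_invertibleIdeals (I * J).2 (congrArg Subtype.val hXY)

lemma isAdditive_of_catenaryDegree_invertibleIdeals_le
    (h : catenaryDegree (invertibleIdeals R) ≤ 2) : A.invertibleSystem.IsAdditive :=
  A.invertibleSystem.isAdditive_of_size fun I J =>
    A.invertibleSystem.size_mul_of_catenaryDegree_le h fun _ _ hXY => Subtype.ext <|
      mul_left_cancel_of_mem_invertibleIdeals (I * J).2 (congrArg Subtype.val hXY)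

end LocalParameters

end IdealMonoids

end StableMori

theorem theorem5p9 (R : Type*) [CommRing R] [IsDomain R]
    (hdim : ringKrullDim R = 1)
    (hMori : IsMoriDomain R (FractionRing R))
    (hstable : ∀ m ∈ minimalNonzeroPrimes R, IsStableIdeal (FractionRing R) m)
    (hcond : ∀ (m : Ideal R) [m.IsPrime], m ∈ minimalNonzeroPrimes R →
      completeConductor (Localization.AtPrime m) (FractionRing (Localization.AtPrime m)) ≠ ⊥) :
    -- both ideal semigroups are (unit-cancellative) atomic monoids
    (IsUnitCancellative (nonzeroIdeals R) ∧ IsAtomicMonoid (nonzeroIdeals R) ∧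
      IsUnitCancellative (invertibleIdeals R) ∧ IsAtomicMonoid (invertibleIdeals R)) ∧
    -- the six equivalent conditions
    [ IsTransferKrull (nonzeroIdeals R),
      IsTransferKrull (invertibleIdeals R),
      IsHalfFactorial (invertibleIdeals R),
      IsHalfFactorial (nonzeroIdeals R),
      catenaryDegree (nonzeroIdeals R) ≤ 2,
      catenaryDegree (invertibleIdeals R) ≤ 2 ].TFAE ∧
    -- if they hold, then contraction of primes is bijective
    (IsHalfFactorial (nonzeroIdeals R) →
      Set.BijOn (Ideal.comap (algebraMap R (completeIntegralClosure R (FractionRing R))))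
        (minimalNonzeroPrimes (completeIntegralClosure R (FractionRing R)))
        (minimalNonzeroPrimes R)) ∧
    -- the distance formulas, outside the half-factorial case
    (¬ IsHalfFactorial (nonzeroIdeals R) →
      daleth (nonzeroIdeals R) = 2 + supDelta (nonzeroIdeals R)) ∧
    (¬ IsHalfFactorial (invertibleIdeals R) →
      daleth (invertibleIdeals R) = 2 + supDelta (invertibleIdeals R)) := by
  have : Ring.KrullDimLE 1 R := Ring.krullDimLE_iff.2 hdim.le
  have hR : ¬ IsField R := fun h => by
    rw [ringKrullDim_eq_zero_of_isField h] at hdim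
    exact zero_ne_one hdim
  obtain ⟨A⟩ := exists_localParameters hR hMori hstable hcond
  obtain ⟨p⟩ : Nonempty (MaximalSpectrum R) := inferInstance
  have hN := A.nonzeroSystem.isHalfFactorial_iff
  have hI := A.invertibleSystem.isHalfFactorial_iff
  have hNI := A.isAdditive_nonzeroSystem_iff
  refine ⟨⟨A.nonzeroSystem.isUnitCancellative, A.nonzeroSystem.isAtomicMonoid,
    A.invertibleSystem.isUnitCancellative, A.invertibleSystem.isAtomicMonoid⟩, ?_,
    fun h => A.bijOn_comap (FractionRing R) (A.orderAdditive_of_isAdditive (hN.1 h)) hR,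
    A.nonzeroSystem.daleth_eq, A.invertibleSystem.daleth_eq⟩
  tfae_have 1 → 4 := A.nonzeroSystem.isHalfFactorial_of_isTransferKrull
  tfae_have 4 → 1 := fun h => A.nonzeroSystem.isTransferKrull_of_isAdditive (hN.1 h) p
  tfae_have 2 → 3 := A.invertibleSystem.isHalfFactorial_of_isTransferKrull
  tfae_have 3 → 2 := fun h => A.invertibleSystem.isTransferKrull_of_isAdditive (hI.1 h) p
  tfae_have 3 ↔ 4 := hI.trans (hNI.symm.trans hN.symm)
  tfae_have 4 → 5 := fun h => (hN.1 h).catenaryDegree_le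
  tfae_have 5 → 3 := fun h => hI.2 (A.isAdditive_of_catenaryDegree_nonzeroIdeals_le h)
  tfae_have 3 → 6 := fun h => (hI.1 h).catenaryDegree_le
  tfae_have 6 → 3 := fun h => hI.2 (A.isAdditive_of_catenaryDegree_invertibleIdeals_le h)
  tfae_finish
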